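/- Let $B$ be a C*-algebra and let $Z\subseteq B$ be a $*$-TRO, i.e. a norm closed selfadjoint linear subspace of $B$ with $xy^*z\in Z$ for all $x,y,z\in Z$. For a subspace $V$ of a C*-algebra $D$, give $M_n(V)\subseteq M_n(D)$ the norm of the C*-algebra $M_n(D)$ and put $V_+=V\cap D_+$, $M_n(V)_+=M_n(V)\cap M_n(D)_+$. Write $T_n$ for the entrywise amplification of a linear map $T$ to $n\times n$ matrices. A linear map $T$ between selfadjoint subspaces of C*-algebras is completely positive if $T(x^*)=T(x)^*$ for all $x$ and every $T_n$ maps positive elements to positive elements; it is completely contractive (completely isometric) if every $T_n$ is contractive (isometric). Let $P:Z\to Z$ be a completely positive, completely contractive linear map with $P\circ P=P$. Then: (1) $P(Z)\cap Z_+=P(Z_+)$, and $M_n(P(Z))\cap M_n(Z)_+=P_n(M_n(Z)_+)$ for every $n$. (2) $P(Z)$ is an involutive ternary system: it is selfadjoint, and there is a ternary product $[\cdot,\cdot,\cdot]:P(Z)^3\to P(Z)$ such that, with the matrix norms and the involution inherited from $B$, there is a completely isometric $*$-linear bijection $T$ from $P(Z)$ onto a $*$-TRO in some C*-algebra, with $T([x,y,z])=T(x)T(y)^*T(z)$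 for all $x,y,z\in P(Z)$. (3) For this ternary product, $P(Z)\cap Z_+$ is a natural cone on $P(Z)$: there is a $*$-linear bijection $T$ from $P(Z)$ onto a $*$-TRO $W$ in some C*-algebra with $T([x,y,z])=T(x)T(y)^*T(z)$ for all $x,y,z\in P(Z)$ and $P(Z)\cap Z_+=T^{-1}(W_+)$. Likewise the cones $M_n(P(Z))\cap M_n(Z)_+$ are natural matrix cones on $P(Z)$: there are such $T$ and $W$ with $M_n(P(Z))\cap M_n(Z)_+=T_n^{-1}(M_n(W)_+)$ for every $n$. (4) $P(Z)$ with these matrix cones is completely isometrically and completely order isomorphic to a $*$-TRO: there are a $*$-TRO $W$ in some C*-algebra and a completely isometric linear bijection $T:P(Z)\to W$ such that $T$ and $T^{-1}$ are completely positive. -/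

import Mathlib

universe u v

namespace OrderedTRO

section Basic

variable {B : Type u} [NonUnitalCStarAlgebra B]

/-- A `*`-TRO in the C*-algebra `B`: a norm closed, selfadjoint linear subspace `Z` of `B` with
`Z Z* Z ⊆ Z`. -/
structure IsStarTRO (Z : Submodule ℂ B) : Prop where
  isClosed : IsClosed (Z : Set B)
  star_mem : ∀ x ∈ Z, star x ∈ Z
  triple_mem : ∀ x ∈ Z, ∀ y ∈ Z, ∀ z ∈ Z, x * star y * z ∈ Z

/-- The matrix `x ∈ M_n(V)`, regarded as an element of the C*-algebra `M_n(B) ⊇ M_n(V)`. Its norm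
there is the canonical operator space norm of `x`. -/
def toMat {V : Submodule ℂ B} {n : ℕ} (x : Matrix (Fin n) (Fin n) V) :
    CStarMatrix (Fin n) (Fin n) B :=
  CStarMatrix.ofMatrix (x.map fun a => (a : B))

/-- `M_n(V)` as a subset of `M_n(B)`. -/
def matSpace (V : Submodule ℂ B) (n : ℕ) : Set (CStarMatrix (Fin n) (Fin n) B) :=
  Set.range fun x : Matrix (Fin n) (Fin n) V => toMat x

end Basic

section Cones

variable {B : Type u} [NonUnitalCStarAlgebra B] [PartialOrder B] [StarOrderedRing B]

/-- The inherited positive cone `V_+ = V ∩ B_+`. -/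
def posCone (V : Submodule ℂ B) : Set B := {b | b ∈ V ∧ 0 ≤ b}

/-- The inherited matrix cone `M_n(V)_+ = M_n(V) ∩ M_n(B)_+`. -/
def matPosCone (V : Submodule ℂ B) (n : ℕ) : Set (CStarMatrix (Fin n) (Fin n) B) :=
  {b | b ∈ matSpace V n ∧ 0 ≤ b}

end Cones

section Maps

variable {B : Type u} [NonUnitalCStarAlgebra B] [PartialOrder B] [StarOrderedRing B]
  {A : Type v} [NonUnitalCStarAlgebra A] [PartialOrder A] [StarOrderedRing A]
  {V : Submodule ℂ B} {W : Submodule ℂ A}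

/-- `T` is selfadjoint (`*`-linear), `T (x*) = T (x)*`, for the involutions inherited by the
(selfadjoint) subspaces `V` and `W`. -/
def IsStarLinear (T : V →ₗ[ℂ] W) : Prop :=
  ∀ x y : V, (y : B) = star (x : B) → (T y : A) = star (T x : A)

/-- `T` is completely positive: `*`-linear, and every amplification `T_n` maps `M_n(V)_+` into
`M_n(W)_+`. -/
def IsCompletelyPositive (T : V →ₗ[ℂ] W) : Prop :=
  IsStarLinear T ∧
    ∀ (n : ℕ) (x : Matrix (Fin n) (Fin n) V), 0 ≤ toMat x → 0 ≤ toMat (x.map T)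

/-- `T` is completely contractive: `‖T_n x‖ ≤ ‖x‖` for all `x ∈ M_n(V)` and all `n`. -/
def IsCompletelyContractive (T : V →ₗ[ℂ] W) : Prop :=
  ∀ (n : ℕ) (x : Matrix (Fin n) (Fin n) V), ‖toMat (x.map T)‖ ≤ ‖toMat x‖

/-- `T` is completely isometric: `‖T_n x‖ = ‖x‖` for all `x ∈ M_n(V)` and all `n`. -/
def IsCompletelyIsometric (T : V →ₗ[ℂ] W) : Prop :=
  ∀ (n : ℕ) (x : Matrix (Fin n) (Fin n) V), ‖toMat (x.map T)‖ = ‖toMat x‖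

/-- `T` is a ternary `*`-morphism from `V`, with the ternary product `m`, to the `*`-TRO `W` with
its canonical ternary product `a b* c`. -/
def IsTernaryStarMorphism (m : V → V → V → V) (T : V →ₗ[ℂ] W) : Prop :=
  IsStarLinear T ∧ ∀ x y z : V, (T (m x y z) : A) = (T x : A) * star (T y : A) * (T z : A)

end Maps

section Systems

variable {B : Type u} [NonUnitalCStarAlgebra B] [PartialOrder B] [StarOrderedRing B]

/-- The operator space `V`, with the involution inherited from `B` and the ternary product `m`, is
an involutive ternary system: `V` is selfadjoint, and there is a completely isometric `*`-linear
ternary isomorphism of `V` onto a `*`-TRO in some C*-algebra. The product `m` need not be the one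
of `B`. -/
def IsInvolutiveTernarySystem (V : Submodule ℂ B) (m : V → V → V → V) : Prop :=
  (∀ x ∈ V, star x ∈ V) ∧
    ∃ (A : Type u) (_ : NonUnitalCStarAlgebra A) (_ : PartialOrder A) (_ : StarOrderedRing A)
      (W : Submodule ℂ A), IsStarTRO W ∧
        ∃ T : V ≃ₗ[ℂ] W, IsTernaryStarMorphism m T.toLinearMap ∧
          IsCompletelyIsometric T.toLinearMap

/-- `c` is a natural cone on the involutive ternary system `(V, m)`: there is a ternary
`*`-isomorphism of `V` onto a `*`-TRO `W` for which `c` is the cone pulled back from `W_+`. -/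
def IsNaturalCone (V : Submodule ℂ B) (m : V → V → V → V) (c : Set B) : Prop :=
  ∃ (A : Type u) (_ : NonUnitalCStarAlgebra A) (_ : PartialOrder A) (_ : StarOrderedRing A)
    (W : Submodule ℂ A), IsStarTRO W ∧
      ∃ T : V ≃ₗ[ℂ] W, IsTernaryStarMorphism m T.toLinearMap ∧
        c = {b | ∃ x : V, (x : B) = b ∧ 0 ≤ (T x : A)}

/-- `C n ⊆ M_n(V)`, `n ∈ ℕ`, are natural matrix cones on the involutive ternary system `(V, m)`:
there is a ternary `*`-isomorphism of `V` onto a `*`-TRO `W` for which, for every `n`, `C n` is the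
cone pulled back from `M_n(W)_+`. -/
def IsNaturalMatrixCones (V : Submodule ℂ B) (m : V → V → V → V)
    (C : ∀ n : ℕ, Set (CStarMatrix (Fin n) (Fin n) B)) : Prop :=
  ∃ (A : Type u) (_ : NonUnitalCStarAlgebra A) (_ : PartialOrder A) (_ : StarOrderedRing A)
    (W : Submodule ℂ A), IsStarTRO W ∧
      ∃ T : V ≃ₗ[ℂ] W, IsTernaryStarMorphism m T.toLinearMap ∧
        ∀ n : ℕ, C n = {b | ∃ x : Matrix (Fin n) (Fin n) V,
          toMat x = b ∧ 0 ≤ toMat (x.map T)}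

/-- The range `P(Z)` of a map `P : Z → Z`, as a subspace of the C*-algebra `B` containing `Z`. -/
def rangeIn {Z : Submodule ℂ B} (P : Z →ₗ[ℂ] Z) : Submodule ℂ B :=
  (LinearMap.range P).map Z.subtype

end Systems

end OrderedTRO

/-!
Write `V` for the range and `K` for the kernel of `P`, so that `Z = V ⊕ K`. The equality of the
cones is immediate, since an element of `V` is its own image. For the rest a `*`-linear map `T`
from `V` to a C*-algebra is constructed which is completely isometric, is a complete order
isomorphism onto its range, and satisfies `T (P (x y* z)) = T x (T y)* T z`; it serves for all the
remaining claims at once.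

*Triple products.* Products of two elements of `V` and one of `K`, in any order, lie in `K`
(`mul_mul_mem_mid`, `mul_mul_mem_left`, `mul_mul_mem_right`). On a C*-algebra the vector fields
`z ↦ ‖z‖² a - z a* z` and `z ↦ S z`, `S* = -S`, are tangent to spheres. For suitable `2 × 2`
matrices the projection of such a motion to `V`, which does not increase the norm, is a motion on a
line; the norm is then constant on the line, so the velocity, which is the projection of the triple
product in question, is zero. This makes it possible to pass from `Z` to `Z / K`, and it remains to
realize `Z / K` inside a quotient C*-algebra.

*Order.* Let `posSpan V` be the closed span of the positive elements of `V`. It multiplies `K` into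
`K`, and `posSpan Z ≤ posSpan V ⊔ K`. An element `w` of `V` with `w w* w ∈ K` is zero
(`eq_zero_of_cube_mem`), and therefore `V` multiplies `posSpan Z ⊓ K` into itself. The elements of
`V` thus act as multipliers on `posSpan Z / (posSpan Z ⊓ K)`, which gives a `*`-homomorphism
`orderHom` of an algebra that contains `V`. It sees positivity and is faithful on `posSpan V`.

*The rest of `V`.* To be injective on all of `V`, a second homomorphism `gradedHom` is used, whose
kernel on `V` is exactly `posSpan V`. It lives on a `ℤ/2`-graded algebra in which `V` is odd, and
an odd element `(v, -v)` is combined with its opposite `(-v, v)` (the coordinates of `gradedHom`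
and of `gradedHom ∘ flip`). Since `T v` contains both `gradedHom v` and its negative, `T v ≥ 0`
forces `v ∈ posSpan V`, and there the order is that of `orderHom`. The resulting homomorphism
`modelHom` vanishes on an element `(z, z, -z)` exactly if `z ∈ K` (`modelHom_eq_zero_iff_of_odd`).

*Norm and order.* Both are transferred without any lifting theorem. If `‖T v‖ < r`, soft
thresholding at `r`, which commutes with homomorphisms, sends `v` to some `z ∈ K` with
`‖v - z‖ ≤ r`, and `‖v‖ ≤ ‖v - z‖` since `P` is contractive (`norm_amp_modelHom`). If `T v ≥ 0`, the negative
part of `v` lies in `K`, and `v` is the image under `P` of the positive part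
(`nonneg_of_amp_modelHom`). Both arguments apply verbatim to matrices.
-/

namespace OrderedTRO

/-! ### Soft thresholding -/

section SoftThreshold

/-- The cut-off `s ↦ 1 - r / max r √s`; if `s = t²` with `t ≥ 0` then multiplication by it sends
`t` to `max 0 (t - r)`. -/
noncomputable def softCut (r s : ℝ) : ℝ := 1 - r / max r (Real.sqrt s)

lemma continuous_softCut {r : ℝ} (hr : 0 < r) : Continuous (softCut r) := by
  unfold softCut
  refine continuous_const.sub (continuous_const.div (by fun_prop) fun s => ?_)
  exact (lt_of_lt_of_le hr (le_max_left _ _)).ne'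

lemma softCut_zero {r : ℝ} (hr : 0 < r) : softCut r 0 = 0 := by
  simp [softCut, max_eq_left hr.le, hr.ne']

lemma softCut_eq_zero {r s : ℝ} (hr : 0 < r) (hs : s ≤ r ^ 2) : softCut r s = 0 := by
  have : Real.sqrt s ≤ r := Real.sqrt_le_left hr.le |>.2 hs
  simp [softCut, max_eq_left this, hr.ne']

lemma mul_sq_softCut_le {r s : ℝ} (hr : 0 < r) (hs : 0 ≤ s) :
    s * (1 - softCut r s) ^ 2 ≤ r ^ 2 := by
  have hm : 0 < max r (Real.sqrt s) := lt_of_lt_of_le hr (le_max_left _ _)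
  have h1 : s ≤ max r (Real.sqrt s) ^ 2 := by
    calc s = Real.sqrt s ^ 2 := (Real.sq_sqrt hs).symm
      _ ≤ _ := by gcongr; exact le_max_right _ _
  have : (1 - softCut r s) ^ 2 = r ^ 2 / max r (Real.sqrt s) ^ 2 := by
    simp [softCut, div_pow]
  rw [this, mul_div_assoc', div_le_iff₀ (by positivity), mul_comm]
  gcongr

variable {A : Type u} [NonUnitalCStarAlgebra A]

/-- Soft thresholding of `x` at `r`; on singular values it is `t ↦ max 0 (t - r)`. -/
noncomputable def softThreshold (r : ℝ) (x : A) : A := x * cfcₙ (softCut r) (star x * x)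

lemma norm_sub_softThreshold_le (x : A) {r : ℝ} (hr : 0 < r) : ‖x - softThreshold r x‖ ≤ r := by
  unfold softThreshold
  let _ : PartialOrder A := CStarAlgebra.spectralOrder A
  have : StarOrderedRing A := CStarAlgebra.spectralOrderedRing A
  have hc := continuous_softCut hr
  have h0 := softCut_zero hr
  set a := star x * x with ha
  have ha0 : 0 ≤ a := star_mul_self_nonneg x
  have hsa : IsSelfAdjoint a := .of_nonneg ha0
  set c := cfcₙ (softCut r) a with hcdef
  have hcsa : star c = c := (cfcₙ_predicate (softCut r) a : IsSelfAdjoint c)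
  have hid : a = cfcₙ (fun s : ℝ => s) a := (cfcₙ_id' ℝ a).symm
  have key : star (x - x * c) * (x - x * c) =
      cfcₙ (fun s : ℝ => s * (1 - softCut r s) ^ 2) a := by
    have e1 : star (x - x * c) * (x - x * c) = a - a * c - (c * a - c * a * c) := by
      rw [star_sub, star_mul, hcsa, ha]; noncomm_ring
    have e2 : cfcₙ (fun s : ℝ => s * (1 - softCut r s) ^ 2) a =
        cfcₙ (fun s : ℝ => s - s * softCut r s - (softCut r s * s - softCut r s * s * softCut r s))
          a := by
      congr 1; ext s; ring
    rw [e1, e2, cfcₙ_sub (fun s => s - s * softCut r s)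
      (fun s => softCut r s * s - softCut r s * s * softCut r s) a
      (by fun_prop) (by simp) (by fun_prop) (by simp),
      cfcₙ_sub (fun s => s) (fun s => s * softCut r s) a
      (by fun_prop) (by simp) (by fun_prop) (by simp),
      cfcₙ_sub (fun s => softCut r s * s) (fun s => softCut r s * s * softCut r s) a
      (by fun_prop) (by simp) (by fun_prop) (by simp),
      cfcₙ_mul (fun s => s) (softCut r) a (by fun_prop) (by simp) (by fun_prop) h0,
      cfcₙ_mul (fun s => softCut r s * s) (softCut r) a (by fun_prop) (by simp) (by fun_prop) h0,
      cfcₙ_mul (softCut r) (fun s => s) a (by fun_prop) h0 (by fun_prop) (by simp),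
      ← hid]
  have hn : ‖star (x - x * c) * (x - x * c)‖ ≤ r ^ 2 := by
    rw [key]
    refine norm_cfcₙ_le fun s hs => ?_
    have hs0 : 0 ≤ s := quasispectrum_nonneg_of_nonneg a ha0 s hs
    rw [Real.norm_of_nonneg (by positivity)]
    exact mul_sq_softCut_le hr hs0
  rw [CStarRing.norm_star_mul_self, ← sq] at hn
  exact (sq_le_sq₀ (norm_nonneg _) hr.le).1 hn

lemma softThreshold_eq_zero {x : A} {r : ℝ} (hr : 0 < r) (hx : ‖x‖ ≤ r) :
    softThreshold r x = 0 := by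
  have : cfcₙ (softCut r) (star x * x) = 0 := by
    rw [← cfcₙ_zero ℝ (star x * x)]
    refine cfcₙ_congr fun s hs => ?_
    refine softCut_eq_zero hr ?_
    have h1 : s ≤ ‖star x * x‖ := by
      rw [Unitization.quasispectrum_eq_spectrum_inr' ℝ ℂ] at hs
      calc s ≤ ‖s‖ := Real.le_norm_self s
        _ ≤ _ := spectrum.norm_le_norm_of_mem hs
        _ = _ := Unitization.norm_inr _
    refine h1.trans ?_
    rw [CStarRing.norm_star_mul_self, ← sq]
    gcongr
  rw [softThreshold, this, mul_zero]

lemma softThreshold_neg (r : ℝ) (x : A) : softThreshold r (-x) = -softThreshold r x := by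
  rw [softThreshold, softThreshold, star_neg, neg_mul_neg, neg_mul]

lemma map_softThreshold {A' : Type v} [NonUnitalCStarAlgebra A'] (φ : A →⋆ₙₐ[ℂ] A') (x : A)
    {r : ℝ} (hr : 0 < r) : φ (softThreshold r x) = softThreshold r (φ x) := by
  have hc := continuous_softCut hr
  have hφ : Continuous φ := by
    open scoped CStarAlgebra in exact map_continuous φ
  rw [softThreshold, softThreshold, map_mul, NonUnitalStarAlgHom.map_cfcₙ φ (softCut r)
    (star x * x) (by fun_prop) (softCut_zero hr) hφ (.star_mul_self x)
    (by rw [map_mul, map_star]; exact .star_mul_self _), map_mul, map_star]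

end SoftThreshold

/-! ### First-order stationarity -/

section Flat

open Filter Topology in
/-- A continuous function with `ψ (t + s) ≤ ψ t + s² G t` for all `t`, `s` is constant: its
derivative vanishes identically. -/
lemma eq_of_add_le_add_sq_mul {ψ G : ℝ → ℝ} (hG : Continuous G)
    (h : ∀ t s, ψ (t + s) ≤ ψ t + s ^ 2 * G t) (t : ℝ) : ψ t = ψ 0 := by
  have hd : ∀ t, HasDerivAt ψ 0 t := by
    intro t
    rw [hasDerivAt_iff_isLittleO_nhds_zero]
    have hb : (fun s => ψ (t + s) - ψ t - s • (0 : ℝ)) =O[𝓝 0] fun s : ℝ => s ^ 2 := by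
      have hc : ContinuousAt (fun s => |G t| + |G (t + s)|) 0 := by fun_prop
      have hev := hc.eventually_lt (g := fun _ => |G t| + |G (t + 0)| + 1) continuousAt_const
        (by simp)
      refine Asymptotics.IsBigO.of_bound (|G t| + |G (t + 0)| + 1) ?_
      filter_upwards [hev] with s hs
      have h1 := h t s
      have h2 := h (t + s) (-s)
      rw [add_neg_cancel_right, neg_sq] at h2
      have hs2 : (0 : ℝ) ≤ s ^ 2 := sq_nonneg s
      have a1 : s ^ 2 * G t ≤ s ^ 2 * (|G t| + |G (t + s)|) := by
        gcongr; linarith [le_abs_self (G t), abs_nonneg (G (t + s))]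
      have a2 : s ^ 2 * G (t + s) ≤ s ^ 2 * (|G t| + |G (t + s)|) := by
        gcongr; linarith [le_abs_self (G (t + s)), abs_nonneg (G t)]
      have a3 : s ^ 2 * (|G t| + |G (t + s)|) ≤ s ^ 2 * (|G t| + |G (t + 0)| + 1) := by gcongr
      rw [smul_zero, sub_zero, Real.norm_eq_abs, abs_le, Real.norm_of_nonneg hs2]
      constructor <;> linarith
    refine hb.trans_isLittleO ?_
    simpa using Asymptotics.isLittleO_pow_pow (𝕜 := ℝ) (show 1 < 2 by norm_num)
  exact is_const_of_deriv_eq_zero (fun t => (hd t).differentiableAt) (fun t => (hd t).deriv) t 0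

end Flat

section Perturbation

variable {A : Type u} [NonUnitalCStarAlgebra A]

/-- The vector fields `z ↦ ρ² a - z a* z` are tangent to the sphere of radius `ρ`. -/
lemma norm_sq_add_smul_quadratic_le_of_unital {A : Type u} [CStarAlgebra A] (z a : A) (s : ℝ) :
    ‖z + s • (‖z‖ ^ 2 • a - z * star a * z)‖ ^ 2 ≤
      ‖z‖ ^ 2 + s ^ 2 * (4 * ‖a‖ ^ 2 * ‖z‖ ^ 4) := by
  let _ : PartialOrder A := CStarAlgebra.spectralOrder A
  have : StarOrderedRing A := CStarAlgebra.spectralOrderedRing A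
  set ρ := ‖z‖
  set M := z + s • (ρ ^ 2 • a - z * star a * z) with hM
  set R := 1 - s • (z * star a) with hR
  -- `M M* = ρ² + s² E - R (ρ² - z z*) R*`: the terms of first order in `s` are absorbed into the
  -- last, negative, summand.
  set E := ρ ^ 2 • (z * star a * (a * star z)) - ρ ^ 2 • (z * star a * (z * star a))
    - ρ ^ 2 • (a * star z * (a * star z)) + ρ ^ 4 • (a * star a) with hE
  have hzz : z * star z ≤ algebraMap ℝ A (ρ ^ 2) := CStarAlgebra.mul_star_le_algebraMap_norm_sq
  have hid : M * star M = algebraMap ℝ A (ρ ^ 2) + s ^ 2 • E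
      - R * (algebraMap ℝ A (ρ ^ 2) - z * star z) * star R := by
    simp only [hM, hR, hE, Algebra.algebraMap_eq_smul_one, star_add, star_sub, star_smul, star_mul,
      star_star, star_one, star_trivial]
    simp only [mul_add, add_mul, mul_sub, sub_mul, smul_add, smul_sub, smul_mul_assoc,
      mul_smul_comm, mul_one, one_mul, smul_smul, mul_assoc]
    module
  have hEsa : IsSelfAdjoint E := by
    simp only [hE, IsSelfAdjoint, star_add, star_sub, star_smul, star_mul, star_star, star_trivial]
    simp only [mul_assoc]
    abel
  have hEn : ‖E‖ ≤ 4 * ‖a‖ ^ 2 * ρ ^ 4 := by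
    have hza : ‖z * star a‖ ≤ ρ * ‖a‖ := (norm_mul_le _ _).trans (by rw [norm_star])
    have haz : ‖a * star z‖ ≤ ‖a‖ * ρ := (norm_mul_le _ _).trans (by rw [norm_star])
    have hρ2 : ‖ρ ^ 2‖ = ρ ^ 2 := Real.norm_of_nonneg (by positivity)
    have hρ4 : ‖ρ ^ 4‖ = ρ ^ 4 := Real.norm_of_nonneg (by positivity)
    have b1 : ‖ρ ^ 2 • (z * star a * (a * star z))‖ ≤ ρ ^ 2 * ((ρ * ‖a‖) * (‖a‖ * ρ)) := by
      rw [norm_smul, hρ2]; gcongr; exact (norm_mul_le _ _).trans (by gcongr)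
    have b2 : ‖ρ ^ 2 • (z * star a * (z * star a))‖ ≤ ρ ^ 2 * ((ρ * ‖a‖) * (ρ * ‖a‖)) := by
      rw [norm_smul, hρ2]; gcongr; exact (norm_mul_le _ _).trans (by gcongr)
    have b3 : ‖ρ ^ 2 • (a * star z * (a * star z))‖ ≤ ρ ^ 2 * ((‖a‖ * ρ) * (‖a‖ * ρ)) := by
      rw [norm_smul, hρ2]; gcongr; exact (norm_mul_le _ _).trans (by gcongr)
    have b4 : ‖ρ ^ 4 • (a * star a)‖ ≤ ρ ^ 4 * (‖a‖ * ‖a‖) := by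
      rw [norm_smul, hρ4]; gcongr; exact (norm_mul_le _ _).trans (by rw [norm_star])
    calc ‖E‖ ≤ _ := norm_add_le _ _
      _ ≤ _ := add_le_add ((norm_sub_le _ _).trans (add_le_add (norm_sub_le _ _) le_rfl)) le_rfl
      _ ≤ _ := add_le_add (add_le_add (add_le_add b1 b2) b3) b4
      _ = _ := by ring
  have hle : M * star M ≤ algebraMap ℝ A (ρ ^ 2 + s ^ 2 * (4 * ‖a‖ ^ 2 * ρ ^ 4)) := by
    have h1 : 0 ≤ R * (algebraMap ℝ A (ρ ^ 2) - z * star z) * star R :=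
      star_right_conjugate_nonneg (sub_nonneg.2 hzz) R
    have h2 : E ≤ algebraMap ℝ A (4 * ‖a‖ ^ 2 * ρ ^ 4) :=
      hEsa.le_algebraMap_norm_self.trans (algebraMap_mono A hEn)
    have h3 : s ^ 2 • E ≤ s ^ 2 • algebraMap ℝ A (4 * ‖a‖ ^ 2 * ρ ^ 4) :=
      smul_le_smul_of_nonneg_left h2 (sq_nonneg s)
    rw [hid, map_add, map_mul, ← Algebra.smul_def]
    exact (sub_le_self _ h1).trans (by gcongr)
  have := (CStarAlgebra.norm_le_iff_le_algebraMap (M * star M) (by positivity)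
    (mul_star_self_nonneg M)).2 hle
  rwa [CStarRing.norm_self_mul_star, ← sq] at this

lemma norm_sq_add_smul_quadratic_le (z a : A) (s : ℝ) :
    ‖z + s • (‖z‖ ^ 2 • a - z * star a * z)‖ ^ 2 ≤
      ‖z‖ ^ 2 + s ^ 2 * (4 * ‖a‖ ^ 2 * ‖z‖ ^ 4) := by
  have h := norm_sq_add_smul_quadratic_le_of_unital (z : Unitization ℂ A) (a : Unitization ℂ A) s
  simp only [Unitization.norm_inr] at h
  rw [← Unitization.norm_inr (𝕜 := ℂ) (z + _)]
  simpa only [Unitization.inr_add, Unitization.inr_smul, Unitization.inr_sub, Unitization.inr_mul,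
    Unitization.inr_star] using h

/-- Left multiplication by a skew element is tangent to the spheres. -/
lemma norm_sq_add_smul_skew_le (S x : A) (hS : star S = -S) (s : ℝ) :
    ‖x + s • (S * x)‖ ^ 2 ≤ ‖x‖ ^ 2 + s ^ 2 * (‖S‖ ^ 2 * ‖x‖ ^ 2) := by
  have e : star (x + s • (S * x)) * (x + s • (S * x)) =
      star x * x + s ^ 2 • (star (S * x) * (S * x)) := by
    simp only [star_add, star_smul, star_mul, hS, star_trivial]
    simp only [mul_add, add_mul, mul_neg, neg_mul, smul_mul_assoc, mul_smul_comm, mul_assoc,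
      smul_neg]
    module
  rw [sq, ← CStarRing.norm_star_mul_self, e]
  refine (norm_add_le _ _).trans ?_
  rw [norm_smul, CStarRing.norm_star_mul_self, CStarRing.norm_star_mul_self,
    Real.norm_of_nonneg (sq_nonneg s), ← sq]
  have : ‖S * x‖ * ‖S * x‖ ≤ (‖S‖ * ‖x‖) * (‖S‖ * ‖x‖) := by
    gcongr <;> exact norm_mul_le _ _
  have h2 := mul_le_mul_of_nonneg_left this (sq_nonneg s)
  nlinarith

end Perturbation

/-! ### Quotients of C*-algebras -/

section Quotient

/-- A closed two-sided selfadjoint ideal of a C*-algebra, as a structure on complex subspaces. -/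
structure ClosedStarIdeal (A : Type u) [NonUnitalCStarAlgebra A] extends Submodule ℂ A where
  isClosed' : IsClosed carrier
  mul_mem_left' : ∀ (a : A) {n : A}, n ∈ carrier → a * n ∈ carrier
  mul_mem_right' : ∀ (a : A) {n : A}, n ∈ carrier → n * a ∈ carrier
  star_mem' : ∀ {n : A}, n ∈ carrier → star n ∈ carrier

namespace ClosedStarIdeal

variable {A : Type u} [NonUnitalCStarAlgebra A] (N : ClosedStarIdeal A)

/-- The quotient C*-algebra `A / N`, with the quotient norm. -/
def Quotient : Type u := A ⧸ N.toSubmodule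

instance : IsClosed (N.toSubmodule : Set A) := N.isClosed'

noncomputable instance : NormedAddCommGroup N.Quotient :=
  inferInstanceAs (NormedAddCommGroup (A ⧸ N.toSubmodule))

noncomputable instance : NormedSpace ℂ N.Quotient :=
  inferInstanceAs (NormedSpace ℂ (A ⧸ N.toSubmodule))

instance : CompleteSpace N.Quotient :=
  inferInstanceAs (CompleteSpace (A ⧸ N.toSubmodule))

/-- The quotient map `A → A / N`. -/
def quotMk : A →ₗ[ℂ] N.Quotient := N.toSubmodule.mkQ

lemma quotMk_surjective : Function.Surjective N.quotMk := N.toSubmodule.mkQ_surjective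

lemma quotMk_eq_zero {a : A} : N.quotMk a = 0 ↔ a ∈ N.toSubmodule :=
  Submodule.Quotient.mk_eq_zero N.toSubmodule

lemma quotMk_eq_mk {a b : A} : N.quotMk a = N.quotMk b ↔ a - b ∈ N.toSubmodule :=
  Submodule.Quotient.eq N.toSubmodule

lemma norm_quotMk_le (a : A) : ‖N.quotMk a‖ ≤ ‖a‖ :=
  Submodule.Quotient.norm_mk_le (S := N.toSubmodule) a

lemma exists_quotMk_eq_norm_lt (x : N.Quotient) {r : ℝ} (h : ‖x‖ < r) :
    ∃ a, N.quotMk a = x ∧ ‖a‖ < r := by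
  obtain ⟨a, ha, hr⟩ := Submodule.Quotient.norm_mk_lt (S := N.toSubmodule) x (sub_pos.2 h)
  exact ⟨a, ha, hr.trans_eq (add_sub_cancel _ _)⟩

instance : Mul N.Quotient where
  mul := Quotient.map₂ (· * ·) fun a b hab c d hcd => by
    have h1 : a - b ∈ N.toSubmodule := (Submodule.quotientRel_def _).1 hab
    have h2 : c - d ∈ N.toSubmodule := (Submodule.quotientRel_def _).1 hcd
    refine (Submodule.quotientRel_def _).2 ?_
    have : a * c - b * d = (a - b) * c + b * (c - d) := by noncomm_ring
    rw [this]
    exact add_mem (N.mul_mem_right' c h1) (N.mul_mem_left' b h2)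

instance : Star N.Quotient where
  star := Quotient.map star fun a b hab => by
    have h1 : a - b ∈ N.toSubmodule := (Submodule.quotientRel_def _).1 hab
    refine (Submodule.quotientRel_def _).2 ?_
    rw [← star_sub]
    exact N.star_mem' h1

lemma quotMk_mul (a b : A) : N.quotMk (a * b) = N.quotMk a * N.quotMk b := rfl

lemma quotMk_star (a : A) : N.quotMk (star a) = star (N.quotMk a) := rfl

noncomputable instance : NonUnitalRing N.Quotient where
  left_distrib := by
    intro x y z
    obtain ⟨a, rfl⟩ := N.quotMk_surjective x
    obtain ⟨b, rfl⟩ := N.quotMk_surjective y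
    obtain ⟨c, rfl⟩ := N.quotMk_surjective z
    simp only [← map_add, ← quotMk_mul, mul_add]
  right_distrib := by
    intro x y z
    obtain ⟨a, rfl⟩ := N.quotMk_surjective x
    obtain ⟨b, rfl⟩ := N.quotMk_surjective y
    obtain ⟨c, rfl⟩ := N.quotMk_surjective z
    simp only [← map_add, ← quotMk_mul, add_mul]
  zero_mul := by
    intro x
    obtain ⟨a, rfl⟩ := N.quotMk_surjective x
    rw [← map_zero N.quotMk, ← quotMk_mul, zero_mul]
  mul_zero := by
    intro x
    obtain ⟨a, rfl⟩ := N.quotMk_surjective x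
    rw [← map_zero N.quotMk, ← quotMk_mul, mul_zero]
  mul_assoc := by
    intro x y z
    obtain ⟨a, rfl⟩ := N.quotMk_surjective x
    obtain ⟨b, rfl⟩ := N.quotMk_surjective y
    obtain ⟨c, rfl⟩ := N.quotMk_surjective z
    simp only [← quotMk_mul, mul_assoc]

noncomputable instance : NonUnitalNormedRing N.Quotient where
  dist_eq := dist_eq_norm_neg_add
  norm_mul_le := by
    intro x y
    refine le_of_forall_gt fun r hr => ?_
    obtain ⟨c, d, hc, hd, hcd⟩ : ∃ c d, ‖x‖ < c ∧ ‖y‖ < d ∧ c * d < r := by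
      have hcont : ContinuousAt (fun t : ℝ => (‖x‖ + t) * (‖y‖ + t)) 0 := by fun_prop
      have hev := hcont.eventually_lt (g := fun _ => r) continuousAt_const (by simpa using hr)
      obtain ⟨ε, hε, h⟩ := Metric.eventually_nhds_iff.1 hev
      have := h (y := ε / 2) (by
        rw [Real.dist_eq, sub_zero, abs_of_pos (by positivity)]; linarith)
      exact ⟨_, _, lt_add_of_pos_right _ (by positivity), lt_add_of_pos_right _ (by positivity),
        this⟩
    obtain ⟨a, rfl, ha⟩ := N.exists_quotMk_eq_norm_lt x hc
    obtain ⟨b, rfl, hb⟩ := N.exists_quotMk_eq_norm_lt y hd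
    rw [← quotMk_mul]
    calc ‖N.quotMk (a * b)‖ ≤ ‖a * b‖ := N.norm_quotMk_le _
      _ ≤ ‖a‖ * ‖b‖ := norm_mul_le _ _
      _ ≤ c * d := mul_le_mul ha.le hb.le (norm_nonneg _) ((norm_nonneg _).trans ha.le)
      _ < r := hcd

instance : StarRing N.Quotient where
  star_involutive := by
    intro x
    obtain ⟨a, rfl⟩ := N.quotMk_surjective x
    simp only [← quotMk_star, star_star]
  star_add := by
    intro x y
    obtain ⟨a, rfl⟩ := N.quotMk_surjective x
    obtain ⟨b, rfl⟩ := N.quotMk_surjective y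
    simp only [← quotMk_star, ← map_add, star_add]
  star_mul := by
    intro x y
    obtain ⟨a, rfl⟩ := N.quotMk_surjective x
    obtain ⟨b, rfl⟩ := N.quotMk_surjective y
    simp only [← quotMk_star, ← quotMk_mul, star_mul]

instance : StarModule ℂ N.Quotient where
  star_smul := by
    intro t x
    obtain ⟨a, rfl⟩ := N.quotMk_surjective x
    simp only [← quotMk_star, ← map_smul, star_smul]

instance : IsScalarTower ℂ N.Quotient N.Quotient where
  smul_assoc := by
    intro t x y
    obtain ⟨a, rfl⟩ := N.quotMk_surjective x
    obtain ⟨b, rfl⟩ := N.quotMk_surjective y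
    simp only [smul_eq_mul, ← quotMk_mul, ← map_smul, smul_mul_assoc]

instance : SMulCommClass ℂ N.Quotient N.Quotient where
  smul_comm := by
    intro t x y
    obtain ⟨a, rfl⟩ := N.quotMk_surjective x
    obtain ⟨b, rfl⟩ := N.quotMk_surjective y
    simp only [smul_eq_mul, ← quotMk_mul, ← map_smul, mul_smul_comm]

/-- Elements of a closed ideal act almost as `0` after multiplication by `1 - g` on both sides, for
some `g` in the ideal with `‖1 - g‖ ≤ 1`. -/
lemma exists_cutoff {n : A} (hn : n ∈ N.toSubmodule) (hsa : IsSelfAdjoint n) {ε : ℝ}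
    (hε : 0 < ε) : ∃ g ∈ N.toSubmodule, star g = g ∧
      ‖(1 : Unitization ℂ A) - (g : Unitization ℂ A)‖ ≤ 1 ∧
      ‖(1 - (g : Unitization ℂ A)) * (n : Unitization ℂ A) * (1 - (g : Unitization ℂ A))‖ ≤ ε := by
  set f : ℝ → ℝ := fun t => |t| / (|t| + ε) with hf
  have hfpos : ∀ t : ℝ, 0 < |t| + ε := fun t => by positivity
  have hfc : Continuous f := by
    rw [hf]
    exact continuous_abs.div (by fun_prop) fun t => (hfpos t).ne'
  have hf0 : f 0 = 0 := by simp [hf]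
  set g := cfcₙ f n with hg
  have hgN : g ∈ N.toSubmodule := by
    let S : NonUnitalStarSubalgebra ℂ A :=
      { N.toSubmodule with
        mul_mem' := fun {a} _ _ hb => N.mul_mem_left' a hb
        star_mem' := fun ha => N.star_mem' ha }
    have : IsClosed (S : Set A) := N.isClosed'
    exact cfcₙ_mem (s := S) f hn
  have hnsa : IsSelfAdjoint (n : Unitization ℂ A) := by
    rw [IsSelfAdjoint, ← Unitization.inr_star, hsa.star_eq]
  have hginr : (g : Unitization ℂ A) = cfc f (n : Unitization ℂ A) := by
    rw [← cfcₙ_eq_cfc (by fun_prop) hf0]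
    exact (Unitization.inrNonUnitalStarAlgHom ℂ A).map_cfcₙ f n (by fun_prop) hf0
      Unitization.continuous_inr hsa hnsa
  have h1g : 1 - (g : Unitization ℂ A) = cfc (fun t => 1 - f t) (n : Unitization ℂ A) := by
    rw [cfc_sub (fun _ => 1) f _ (by fun_prop) (by fun_prop), cfc_const_one ℝ _ hnsa, hginr]
  refine ⟨g, hgN, (cfcₙ_predicate f n : IsSelfAdjoint g), ?_, ?_⟩
  · rw [h1g]
    refine norm_cfc_le zero_le_one fun t _ => ?_
    have : f t ≤ 1 := by rw [hf]; exact (div_le_one (hfpos t)).2 (by linarith)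
    have h0 : 0 ≤ f t := by rw [hf]; positivity
    rw [Real.norm_eq_abs, abs_le]; constructor <;> linarith
  · rw [h1g]
    have : cfc (fun t => (1 - f t) * t * (1 - f t)) (n : Unitization ℂ A) =
        cfc (fun t => 1 - f t) (n : Unitization ℂ A) * (n : Unitization ℂ A) *
          cfc (fun t => 1 - f t) (n : Unitization ℂ A) := by
      rw [cfc_mul (fun t => (1 - f t) * t) (fun t => 1 - f t) _ (by fun_prop) (by fun_prop),
        cfc_mul (fun t => 1 - f t) (fun t => t) _ (by fun_prop) (by fun_prop), cfc_id' ℝ _ hnsa]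
    rw [← this]
    refine norm_cfc_le hε.le fun t _ => ?_
    have hone : 1 - f t = ε / (|t| + ε) := by
      rw [hf]; field_simp [(hfpos t).ne']; ring
    rw [hone, norm_mul, norm_mul, Real.norm_of_nonneg (by positivity), Real.norm_eq_abs]
    have h1 : ε / (|t| + ε) ≤ 1 := (div_le_one (hfpos t)).2 (by linarith [abs_nonneg t])
    have h2 : ε / (|t| + ε) * |t| ≤ ε := by
      rw [div_mul_eq_mul_div, div_le_iff₀ (hfpos t)]
      nlinarith [abs_nonneg t]
    calc _ ≤ ε * 1 := by gcongr
      _ = ε := mul_one _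

/-- The C*-identity for the quotient norm. A representative `b` of `a* a` of nearly minimal norm
may be taken selfadjoint; with `g` a cut-off for `b - a* a`, the representative `a (1 - g)` of `a`
satisfies `‖a (1 - g)‖² = ‖(1 - g) a* a (1 - g)‖ ≤ ‖b‖ + ε`. -/
instance : CStarRing N.Quotient where
  norm_mul_self_le := by
    intro x
    obtain ⟨a, rfl⟩ := N.quotMk_surjective x
    rw [← quotMk_star, ← quotMk_mul]
    refine le_of_forall_gt_imp_ge_of_dense fun r' hr' => ?_
    obtain ⟨r, hr, hr'⟩ := exists_between hr'
    obtain ⟨b, hb, hbr⟩ := N.exists_quotMk_eq_norm_lt _ hr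
    have hN : b - star a * a ∈ N.toSubmodule := N.quotMk_eq_mk.1 hb
    set b' := (2⁻¹ : ℂ) • (b + star b) with hb'
    set n := (2⁻¹ : ℂ) • ((b - star a * a) + star (b - star a * a)) with hn
    have hnN : n ∈ N.toSubmodule :=
      N.toSubmodule.smul_mem _ (add_mem hN (N.star_mem' hN))
    have hnsa : IsSelfAdjoint n := by
      rw [IsSelfAdjoint, hn, star_smul, star_add, star_star, add_comm]
      simp
    have hab : star a * a = b' - n := by
      rw [hb', hn]
      simp only [star_sub, star_mul, star_star]
      module
    have hb'r : ‖b'‖ ≤ r := by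
      rw [hb', norm_smul]
      have := norm_add_le b (star b)
      rw [norm_star] at this
      norm_num
      linarith
    obtain ⟨g, hgN, hgs, hg1, hgn⟩ := N.exists_cutoff hnN hnsa (ε := r' - r) (by linarith)
    have hmk : N.quotMk (a - a * g) = N.quotMk a := by
      rw [N.quotMk_eq_mk, sub_sub_cancel_left]
      exact neg_mem (N.mul_mem_left' a hgN)
    have hnorm : ‖a - a * g‖ * ‖a - a * g‖ ≤ r' := by
      rw [← CStarRing.norm_star_mul_self, ← Unitization.norm_inr (𝕜 := ℂ)]
      have e : ((star (a - a * g) * (a - a * g) : A) : Unitization ℂ A) =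
          (1 - (g : Unitization ℂ A)) * (b' : Unitization ℂ A) * (1 - (g : Unitization ℂ A)) -
          (1 - (g : Unitization ℂ A)) * (n : Unitization ℂ A) * (1 - (g : Unitization ℂ A)) := by
        rw [← sub_mul, ← mul_sub, ← Unitization.inr_sub, ← hab, star_sub, star_mul, hgs]
        simp only [Unitization.inr_sub, Unitization.inr_mul]
        noncomm_ring
      rw [e]
      refine (norm_sub_le _ _).trans ?_
      have h1 : ‖(1 - (g : Unitization ℂ A)) * (b' : Unitization ℂ A) *
          (1 - (g : Unitization ℂ A))‖ ≤ 1 * r * 1 := by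
        refine (norm_mul_le _ _).trans ?_
        have hr0 : 0 ≤ r := (norm_nonneg _).trans hb'r
        gcongr
        refine (norm_mul_le _ _).trans ?_
        gcongr
        rwa [Unitization.norm_inr]
      linarith
    have h2 := N.norm_quotMk_le (a - a * g)
    rw [hmk] at h2
    exact (mul_self_le_mul_self (norm_nonneg _) h2).trans hnorm

noncomputable instance : NonUnitalCStarAlgebra N.Quotient where

/-- The quotient map as a `*`-homomorphism. -/
noncomputable def quotHom : A →⋆ₙₐ[ℂ] N.Quotient where
  __ := N.quotMk
  map_zero' := map_zero N.quotMk
  map_mul' := N.quotMk_mul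
  map_star' := N.quotMk_star

lemma quotHom_eq_zero {a : A} : N.quotHom a = 0 ↔ a ∈ N.toSubmodule := N.quotMk_eq_zero

end ClosedStarIdeal
end Quotient

/-! ### Positivity and homomorphisms -/

section Homs

variable {A : Type u} [NonUnitalCStarAlgebra A] [PartialOrder A] [StarOrderedRing A]
  {A' : Type v} [NonUnitalCStarAlgebra A'] [PartialOrder A'] [StarOrderedRing A']

lemma exists_eq_star_mul_self {a : A} (ha : 0 ≤ a) : ∃ s, a = star s * s :=
  CStarAlgebra.nonneg_iff_eq_star_mul_self.1 ha

lemma nonneg_map (φ : A →⋆ₙₐ[ℂ] A') {a : A} (ha : 0 ≤ a) : 0 ≤ φ a := by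
  obtain ⟨s, rfl⟩ := exists_eq_star_mul_self ha
  rw [map_mul, map_star]
  exact star_mul_self_nonneg _

/-- The negative part of a selfadjoint element `a`; it is `0` if `a` is not selfadjoint. Having it,
like `softThreshold`, as a definition for all C*-algebras makes it applicable to matrices, where the
functional calculus over `ℝ` is not found directly. -/
noncomputable def negPart (a : A) : A := a⁻

lemma negPart_eq_zero_iff {a : A} (ha : IsSelfAdjoint a) : negPart a = 0 ↔ 0 ≤ a :=
  CFC.negPart_eq_zero_iff a

lemma add_negPart_nonneg {a : A} (ha : IsSelfAdjoint a) : 0 ≤ a + negPart a := by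
  rw [negPart, ← eq_add_of_sub_eq (CFC.posPart_sub_negPart a)]
  exact CFC.posPart_nonneg a

omit [PartialOrder A] [StarOrderedRing A] [PartialOrder A'] [StarOrderedRing A'] in
lemma map_negPart (φ : A →⋆ₙₐ[ℂ] A') {a : A} (ha : IsSelfAdjoint a) :
    φ (negPart a) = negPart (φ a) := by
  have hφ : Continuous φ := by
    open scoped CStarAlgebra in exact map_continuous φ
  rw [negPart, negPart, CFC.negPart_def, CFC.negPart_def]
  exact NonUnitalStarAlgHom.map_cfcₙ φ _ a (by fun_prop) (by simp) hφ ha (ha.map φ)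

lemma nonneg_of_nonneg_map (φ : A →⋆ₙₐ[ℂ] A') (hφ : Function.Injective φ) {a : A}
    (ha : 0 ≤ φ a) : 0 ≤ a := by
  have hsa : IsSelfAdjoint a := by
    apply hφ
    rw [map_star]
    exact (IsSelfAdjoint.of_nonneg ha).star_eq
  rw [← negPart_eq_zero_iff hsa]
  apply hφ
  rw [map_negPart φ hsa, map_zero]
  exact (negPart_eq_zero_iff (hsa.map φ)).2 ha

end Homs

/-! ### Triple products of the range and the kernel -/

section Rigidity

/-- A line along which the norm is stationary to first order at each of its points has no
direction: the norm would be constant on it. -/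
lemma eq_zero_of_norm_sq_le {E : Type u} [NormedAddCommGroup E] [NormedSpace ℝ E] {z d : E}
    {G : ℝ → ℝ} (hG : Continuous G)
    (h : ∀ t s : ℝ, ‖z + (t + s) • d‖ ^ 2 ≤ ‖z + t • d‖ ^ 2 + s ^ 2 * G t) : d = 0 := by
  have hc := eq_of_add_le_add_sq_mul (ψ := fun t => ‖z + t • d‖ ^ 2) hG h
  by_contra hd
  have hd' : 0 < ‖d‖ := norm_pos_iff.2 hd
  have h1 := hc ((2 * ‖z‖ + 1) / ‖d‖)
  simp only [zero_smul, add_zero] at h1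
  rw [sq_eq_sq₀ (norm_nonneg _) (norm_nonneg _)] at h1
  have h2 := norm_sub_le (z + ((2 * ‖z‖ + 1) / ‖d‖) • d) z
  rw [add_sub_cancel_left, norm_smul, Real.norm_of_nonneg (by positivity),
    div_mul_cancel₀ _ hd'.ne', h1] at h2
  linarith

end Rigidity

section Splitting

variable {B : Type u} [NonUnitalCStarAlgebra B] [PartialOrder B] [StarOrderedRing B]

variable (B) in
/-- The identification of `B` with the `1 × 1` matrices over `B`. -/
noncomputable def oneByOne : B →⋆ₙₐ[ℂ] CStarMatrix (Fin 1) (Fin 1) B where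
  toFun b := CStarMatrix.ofMatrix fun _ _ => b
  map_smul' _ _ := rfl
  map_zero' := rfl
  map_add' _ _ := rfl
  map_mul' _ _ := by ext; simp [CStarMatrix.mul_apply]; rfl
  map_star' _ := rfl

variable (B) in
omit [PartialOrder B] [StarOrderedRing B] in
lemma oneByOne_injective : Function.Injective (oneByOne B) :=
  fun _ _ h => congrFun (congrFun h 0) 0

/-- `Z = V ⊕ K` is the decomposition of a `*`-TRO into the range and the kernel of a completely
positive completely contractive idempotent; the idempotent is encoded by the matrix inequalities
`‖x‖ ≤ ‖x + y‖` and `0 ≤ x + y → 0 ≤ x` for `x ∈ M_n(V)`, `y ∈ M_n(K)`. -/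
structure IsSplitting (Z V K : Submodule ℂ B) : Prop where
  tro : IsStarTRO Z
  left_le : V ≤ Z
  right_le : K ≤ Z
  left_closed : IsClosed (V : Set B)
  right_closed : IsClosed (K : Set B)
  left_star : ∀ x ∈ V, star x ∈ V
  right_star : ∀ x ∈ K, star x ∈ K
  exists_sub_mem : ∀ z ∈ Z, ∃ v ∈ V, z - v ∈ K
  norm_le : ∀ (n : ℕ) (x y : CStarMatrix (Fin n) (Fin n) B), (∀ i j, x i j ∈ V) →
    (∀ i j, y i j ∈ K) → ‖x‖ ≤ ‖x + y‖
  nonneg : ∀ (n : ℕ) (x y : CStarMatrix (Fin n) (Fin n) B), (∀ i j, x i j ∈ V) →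
    (∀ i j, y i j ∈ K) → 0 ≤ x + y → 0 ≤ x

variable {Z V K : Submodule ℂ B}

omit [PartialOrder B] [StarOrderedRing B] in
lemma IsStarTRO.mul_mul_mem (h : IsStarTRO Z) {x y z : B} (hx : x ∈ Z) (hy : y ∈ Z) (hz : z ∈ Z) :
    x * y * z ∈ Z := by
  simpa using h.triple_mem x hx (star y) (h.star_mem y hy) z hz

namespace IsSplitting

lemma norm_le_scalar (h : IsSplitting Z V K) {x y : B} (hx : x ∈ V) (hy : y ∈ K) :
    ‖x‖ ≤ ‖x + y‖ := by
  let φ := oneByOne B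
  have hn : ∀ b : B, ‖φ b‖ = ‖b‖ := NonUnitalStarAlgHom.norm_map φ (oneByOne_injective B)
  have := h.norm_le 1 (φ x) (φ y) (fun _ _ => hx) (fun _ _ => hy)
  rwa [← map_add, hn, hn] at this

lemma nonneg_scalar (h : IsSplitting Z V K) {x y : B} (hx : x ∈ V) (hy : y ∈ K)
    (hxy : 0 ≤ x + y) : 0 ≤ x := by
  let φ := oneByOne B
  have := h.nonneg 1 (φ x) (φ y) (fun _ _ => hx) (fun _ _ => hy)
    (by rw [← map_add]; exact nonneg_map φ hxy)
  exact nonneg_of_nonneg_map φ (oneByOne_injective B) this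

lemma eq_zero_of_mem (h : IsSplitting Z V K) {x : B} (hx : x ∈ V) (hx' : x ∈ K) : x = 0 := by
  have := h.norm_le_scalar hx (neg_mem hx')
  rwa [add_neg_cancel, norm_zero, norm_le_zero_iff] at this

/-- `V K V ⊆ K`. For `z` upper triangular over
`V` and `a` with only a lower left entry from `K`, moving `z` along the tangent field
`ρ² a - z a* z` and projecting to `V` shifts only the corner entry of `z`, linearly in time;
since that motion preserves the norm to first order, the velocity must vanish. -/
lemma mul_mul_mem_mid (h : IsSplitting Z V K) {v k w : B} (hv : v ∈ V) (hk : k ∈ K) (hw : w ∈ V) :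
    v * k * w ∈ K := by
  obtain ⟨d, hd, hdk⟩ := h.exists_sub_mem (v * k * w)
    (h.tro.mul_mul_mem (h.left_le hv) (h.right_le hk) (h.left_le hw))
  let z : CStarMatrix (Fin 2) (Fin 2) B := CStarMatrix.ofMatrix !![v, 0; 0, w]
  let D : CStarMatrix (Fin 2) (Fin 2) B := CStarMatrix.ofMatrix !![0, d; 0, 0]
  let a : CStarMatrix (Fin 2) (Fin 2) B := CStarMatrix.ofMatrix !![0, 0; star k, 0]
  have hD : D = 0 := by
    refine eq_zero_of_norm_sq_le (z := z) (G := fun t => 4 * ‖a‖ ^ 2 * ‖z + t • D‖ ^ 4)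
      (by fun_prop) fun t s => ?_
    have hq := norm_sq_add_smul_quadratic_le (z + t • D) a (-s)
    rw [neg_sq] at hq
    refine le_trans ?_ hq
    gcongr
    set ρ := ‖z + t • D‖
    let y : CStarMatrix (Fin 2) (Fin 2) B :=
      CStarMatrix.ofMatrix !![0, s • (v * k * w - d); -(s • ρ ^ 2 • star k), 0]
    have e : z + t • D + -s • (ρ ^ 2 • a - (z + t • D) * star a * (z + t • D)) =
        (z + (t + s) • D) + y := by
      ext i j
      fin_cases i <;> fin_cases j <;>
        simp [z, D, a, y, CStarMatrix.mul_apply, Fin.sum_univ_two, CStarMatrix.star_apply,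
          smul_sub, add_smul]
    have key := h.norm_le 2 (z + (t + s) • D) y (fun i j => ?_) (fun i j => ?_)
    · rw [← e] at key
      exact key
    · have : ∀ r : ℝ, r • d ∈ V := fun r => V.smul_of_tower_mem r hd
      fin_cases i <;> fin_cases j <;> simp [z, D, hv, hw, this]
    · have h1 : ∀ r : ℝ, r • (v * k * w - d) ∈ K := fun r => K.smul_of_tower_mem r hdk
      have h2 : ∀ r : ℝ, r • ρ ^ 2 • star k ∈ K := fun r =>
        K.smul_of_tower_mem r (K.smul_of_tower_mem _ (h.right_star k hk))
      fin_cases i <;> fin_cases j <;> simp [y, h1, h2]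
  have : d = 0 := by simpa [D] using congrFun (congrFun hD 0) 1
  simpa [this] using hdk

/-- `K V V ⊆ K`. The skew element with corners `k v` and `-(k v)*` generates an isometric flow on
columns; by `mul_mul_mem_mid` its projection to `V` is a nilpotent shift of the upper entry, which
must vanish for the same reason as before. -/
lemma mul_mul_mem_left (h : IsSplitting Z V K) {v k w : B} (hk : k ∈ K) (hv : v ∈ V) (hw : w ∈ V) :
    k * v * w ∈ K := by
  obtain ⟨d, hd, hdk⟩ := h.exists_sub_mem (k * v * w)
    (h.tro.mul_mul_mem (h.right_le hk) (h.left_le hv) (h.left_le hw))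
  let x : CStarMatrix (Fin 2) (Fin 2) B := CStarMatrix.ofMatrix !![0, 0; w, 0]
  let D : CStarMatrix (Fin 2) (Fin 2) B := CStarMatrix.ofMatrix !![d, 0; 0, 0]
  let S : CStarMatrix (Fin 2) (Fin 2) B :=
    CStarMatrix.ofMatrix !![0, k * v; -(star v * star k), 0]
  have hS : star S = -S := by
    ext i j
    fin_cases i <;> fin_cases j <;> simp [S, CStarMatrix.star_apply]
  have hD : D = 0 := by
    refine eq_zero_of_norm_sq_le (z := x) (G := fun t => ‖S‖ ^ 2 * ‖x + t • D‖ ^ 2)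
      (by fun_prop) fun t s => ?_
    refine le_trans ?_ (norm_sq_add_smul_skew_le S (x + t • D) hS s)
    gcongr
    let y : CStarMatrix (Fin 2) (Fin 2) B :=
      CStarMatrix.ofMatrix !![s • (k * v * w - d), 0; -(s • t • (star v * star k * d)), 0]
    have e : x + t • D + s • (S * (x + t • D)) = (x + (t + s) • D) + y := by
      ext i j
      fin_cases i <;> fin_cases j <;>
        simp [x, D, S, y, CStarMatrix.mul_apply, Fin.sum_univ_two, smul_sub, add_smul,
            mul_smul_comm t]
    have key := h.norm_le 2 (x + (t + s) • D) y (fun i j => ?_) (fun i j => ?_)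
    · rw [← e] at key
      exact key
    · have : ∀ r : ℝ, r • d ∈ V := fun r => V.smul_of_tower_mem r hd
      fin_cases i <;> fin_cases j <;> simp [x, D, hw, this]
    · have h1 : ∀ r : ℝ, r • (k * v * w - d) ∈ K := fun r => K.smul_of_tower_mem r hdk
      have h2 : ∀ r : ℝ, r • t • (star v * star k * d) ∈ K := fun r =>
        K.smul_of_tower_mem r (K.smul_of_tower_mem _
          (h.mul_mul_mem_mid (h.left_star v hv) (h.right_star k hk) hd))
      fin_cases i <;> fin_cases j <;> simp [y, h1, h2]
  have : d = 0 := by simpa [D] using congrFun (congrFun hD 0) 0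
  simpa [this] using hdk

lemma mul_mul_mem_right (h : IsSplitting Z V K) {v k w : B} (hv : v ∈ V) (hw : w ∈ V) (hk : k ∈ K) :
    v * w * k ∈ K := by
  have := h.right_star _ (h.mul_mul_mem_left (h.right_star k hk) (h.left_star w hw)
    (h.left_star v hv))
  simpa [mul_assoc] using this

end IsSplitting

end Splitting

/-! ### Closed spans of positive elements -/

section ClosedSubmodules

variable {B : Type u} [NonUnitalCStarAlgebra B]

lemma cfcₙ_mem_of_isClosed {S : Submodule ℂ B} (hS : IsClosed (S : Set B))
    (hmul : ∀ a ∈ S, ∀ b ∈ S, a * b ∈ S) (hstar : ∀ a ∈ S, star a ∈ S) (f : ℝ → ℝ) {a : B}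
    (ha : a ∈ S) : cfcₙ f a ∈ S := by
  let S' : NonUnitalStarSubalgebra ℂ B :=
    { S with
      mul_mem' := fun {a b} ha hb => hmul a ha b hb
      star_mem' := fun {a} ha => hstar a ha }
  have : IsClosed (S' : Set B) := hS
  exact cfcₙ_mem (s := S') f ha

/-- The elements `c` with `c S ⊆ R` and `S c ⊆ R`. -/
def mulInto (S R : Submodule ℂ B) : Submodule ℂ B where
  carrier := {c | ∀ s ∈ S, c * s ∈ R ∧ s * c ∈ R}
  add_mem' := fun ha hb s hs => by
    rw [add_mul, mul_add]
    exact ⟨add_mem (ha s hs).1 (hb s hs).1, add_mem (ha s hs).2 (hb s hs).2⟩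
  zero_mem' := fun s _ => by simp
  smul_mem' := fun t c hc s hs => by
    rw [smul_mul_assoc, mul_smul_comm]
    exact ⟨R.smul_mem t (hc s hs).1, R.smul_mem t (hc s hs).2⟩

variable {S R R' T : Submodule ℂ B}

lemma isClosed_mulInto (hR : IsClosed (R : Set B)) : IsClosed (mulInto S R : Set B) := by
  have : (mulInto S R : Set B) = ⋂ s ∈ S, {c | c * s ∈ R} ∩ {c | s * c ∈ R} := by
    ext c; simp [mulInto]
  rw [this]
  exact isClosed_biInter fun s _ =>
    (hR.preimage (by fun_prop : Continuous fun c : B => c * s)).inter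
      (hR.preimage (by fun_prop : Continuous fun c : B => s * c))

lemma star_mem_mulInto (hS : ∀ x ∈ S, star x ∈ S) (hR : ∀ x ∈ R, star x ∈ R) {c : B}
    (hc : c ∈ mulInto S R) : star c ∈ mulInto S R := fun s hs => by
  have h := hc (star s) (hS s hs)
  constructor
  · simpa using hR _ h.2
  · simpa using hR _ h.1

lemma mul_mem_mulInto {c d : B} (hd : d ∈ mulInto S R') (hd' : d ∈ mulInto R T)
    (hc : c ∈ mulInto S R) (hc' : c ∈ mulInto R' T) : d * c ∈ mulInto S T := fun s hs => by
  constructor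
  · rw [mul_assoc]; exact (hd' _ (hc s hs).1).1
  · rw [← mul_assoc]; exact (hc' _ (hd s hs).2).2

lemma mul_mem_mulInto_self {c d : B} (hd : d ∈ mulInto S S) (hc : c ∈ mulInto S S) :
    d * c ∈ mulInto S S := mul_mem_mulInto hd hd hc hc

/-- The coefficient of `t` in a hermitian quadratic expression, recovered from the values at the
fourth roots of unity. -/
lemma mem_of_polarization {p q q' r : B}
    (h : ∀ t : ℂ, p + t • q + star t • q' + (t * star t) • r ∈ T) : q ∈ T := by
  have e : q = (4⁻¹ : ℂ) • ((p + (1 : ℂ) • q + star (1 : ℂ) • q' + ((1 : ℂ) * star 1) • r)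
      - (p + (-1 : ℂ) • q + star (-1 : ℂ) • q' + ((-1 : ℂ) * star (-1)) • r)
      - Complex.I • ((p + Complex.I • q + star Complex.I • q' + (Complex.I * star Complex.I) • r)
      - (p + (-Complex.I) • q + star (-Complex.I) • q' +
        ((-Complex.I) * star (-Complex.I)) • r))) := by
    simp only [star_one, star_neg, Complex.star_def, Complex.conj_I, smul_add, smul_sub, smul_smul]
    ring_nf
    simp only [Complex.I_sq]
    module
  rw [e]
  exact T.smul_mem _ (sub_mem (sub_mem (h 1) (h (-1)))
    (T.smul_mem _ (sub_mem (h Complex.I) (h (-Complex.I)))))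

lemma negPart_mem_of_isClosed (hS : IsClosed (S : Set B))
    (hmul : ∀ a ∈ S, ∀ b ∈ S, a * b ∈ S) (hstar : ∀ a ∈ S, star a ∈ S) {a : B}
    (ha : a ∈ S) : negPart a ∈ S :=
  cfcₙ_mem_of_isClosed hS hmul hstar _ ha

variable [PartialOrder B] [StarOrderedRing B]

/-- A closed `*`-subalgebra contains the positive square roots of its elements. -/
lemma mem_of_mul_self_mem (hS : IsClosed (S : Set B))
    (hmul : ∀ a ∈ S, ∀ b ∈ S, a * b ∈ S) (hstar : ∀ a ∈ S, star a ∈ S) {a : B} (ha : 0 ≤ a)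
    (haa : a * a ∈ S) : a ∈ S := by
  rw [← CFC.sqrt_mul_self a ha, CFC.sqrt_eq_real_sqrt (a * a) (by
    simpa [(IsSelfAdjoint.of_nonneg ha).star_eq] using star_mul_self_nonneg a)]
  exact cfcₙ_mem_of_isClosed hS hmul hstar _ haa

/-- The closed linear span of the positive cone of `V`. -/
noncomputable def posSpan (V : Submodule ℂ B) : Submodule ℂ B :=
  (Submodule.span ℂ (posCone V)).topologicalClosure

omit [StarOrderedRing B] in
lemma isClosed_posSpan (V : Submodule ℂ B) : IsClosed (posSpan V : Set B) :=
  Submodule.isClosed_topologicalClosure _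

omit [StarOrderedRing B] in
lemma span_posCone_le_posSpan (V : Submodule ℂ B) : Submodule.span ℂ (posCone V) ≤ posSpan V :=
  Submodule.le_topologicalClosure _

omit [StarOrderedRing B] in
lemma mem_posSpan_of_nonneg {V : Submodule ℂ B} {b : B} (hb : b ∈ V) (h0 : 0 ≤ b) :
    b ∈ posSpan V := span_posCone_le_posSpan V (Submodule.subset_span ⟨hb, h0⟩)

omit [StarOrderedRing B] in
lemma posSpan_le (hS : IsClosed (S : Set B)) {V : Submodule ℂ B}
    (h : ∀ b ∈ V, 0 ≤ b → b ∈ S) : posSpan V ≤ S :=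
  Submodule.topologicalClosure_minimal _ (Submodule.span_le.2 fun b hb => h b hb.1 hb.2) hS

omit [StarOrderedRing B] in
lemma mul_mem_of_mem_posSpan_right (hS : IsClosed (S : Set B)) {V : Submodule ℂ B} {a : B}
    (h : ∀ b ∈ V, 0 ≤ b → a * b ∈ S) {b : B} (hb : b ∈ posSpan V) : a * b ∈ S :=
  posSpan_le (S := S.comap (LinearMap.mulLeft ℂ a))
    (hS.preimage (by fun_prop : Continuous fun c : B => a * c)) h hb

lemma star_mem_posSpan {V : Submodule ℂ B} {b : B} (hb : b ∈ posSpan V) :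
    star b ∈ posSpan V := by
  have hcl : IsClosed {b : B | star b ∈ posSpan V} :=
    (isClosed_posSpan V).preimage continuous_star
  let S : Submodule ℂ B :=
    { carrier := {b : B | star b ∈ posSpan V}
      add_mem' := fun {a b} ha hb => by
        change star (a + b) ∈ posSpan V
        rw [star_add]; exact add_mem ha hb
      zero_mem' := by
        change star 0 ∈ posSpan V
        rw [star_zero]; exact zero_mem _
      smul_mem' := fun t a ha => by
        change star (t • a) ∈ posSpan V
        rw [star_smul]; exact Submodule.smul_mem _ _ ha }
  exact posSpan_le (S := S) hcl (fun b hb h0 => by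
    change star b ∈ posSpan V
    rw [(IsSelfAdjoint.of_nonneg h0).star_eq]; exact mem_posSpan_of_nonneg hb h0) hb

omit [StarOrderedRing B] in
lemma posSpan_mono {V V' : Submodule ℂ B} (h : V ≤ V') : posSpan V ≤ posSpan V' :=
  posSpan_le (isClosed_posSpan _) fun _ hb h0 => mem_posSpan_of_nonneg (h hb) h0

/-- The entries of a positive matrix over `V` are combinations of positive elements of `V`. -/
lemma entry_mem_span_posCone {V : Submodule ℂ B} {n : ℕ} {x : CStarMatrix (Fin n) (Fin n) B}
    (hx : ∀ i j, x i j ∈ V) (h0 : 0 ≤ x) (i j : Fin n) :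
    x i j ∈ Submodule.span ℂ (posCone V) := by
  obtain ⟨s, rfl⟩ := exists_eq_star_mul_self h0
  refine mem_of_polarization (p := (star s * s) i i) (q' := (star s * s) j i)
    (r := (star s * s) j j) fun t => Submodule.subset_span ⟨?_, ?_⟩
  · exact add_mem (add_mem (add_mem (hx i i) (V.smul_mem _ (hx i j))) (V.smul_mem _ (hx j i)))
      (V.smul_mem _ (hx j j))
  · have : (star s * s) i i + t • (star s * s) i j + star t • (star s * s) j i +
        (t * star t) • (star s * s) j j = ∑ k, star (s k i + t • s k j) * (s k i + t • s k j) := by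
      simp only [CStarMatrix.mul_apply, CStarMatrix.star_apply, Finset.smul_sum,
        ← Finset.sum_add_distrib]
      refine Finset.sum_congr rfl fun k _ => ?_
      simp only [star_add, star_smul, mul_add, add_mul, smul_mul_assoc, mul_smul_comm]
      module
    rw [this]
    exact Finset.sum_nonneg fun k _ => star_mul_self_nonneg _

end ClosedSubmodules

/-! ### Positive elements of the range act on the kernel -/

section Splitting

variable {B : Type u} [NonUnitalCStarAlgebra B] [PartialOrder B] [StarOrderedRing B]
  {Z V K : Submodule ℂ B}

/-- A positive element of a `*`-TRO multiplies it into itself: its square does, by the triple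
product, and it is the square root of its square. -/
lemma IsStarTRO.mem_mulInto_of_nonneg (hZ : IsStarTRO Z) {p : B} (hp : p ∈ Z) (h0 : 0 ≤ p) :
    p ∈ mulInto Z Z := by
  refine mem_of_mul_self_mem (isClosed_mulInto hZ.isClosed) (fun a ha b hb =>
    mul_mem_mulInto_self ha hb) (fun a ha => star_mem_mulInto hZ.star_mem hZ.star_mem ha) h0
    fun z hz => ⟨hZ.mul_mul_mem hp hp hz, ?_⟩
  rw [← mul_assoc]
  exact hZ.mul_mul_mem hz hp hp

/-- `posSpan Z` absorbs left multiplication by `Z`: polarize `(1 + t z) p (1 + t z)* ≥ 0`. -/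
lemma IsStarTRO.mul_mem_posSpan_left (hZ : IsStarTRO Z) {z j : B} (hz : z ∈ Z)
    (hj : j ∈ posSpan Z) : z * j ∈ posSpan Z := by
  refine mul_mem_of_mem_posSpan_right (isClosed_posSpan Z) (fun p hp h0 => ?_) hj
  refine span_posCone_le_posSpan Z ?_
  have hpz := hZ.mem_mulInto_of_nonneg hp h0
  refine mem_of_polarization (p := p) (q' := p * star z) (r := z * p * star z)
    fun t => Submodule.subset_span ⟨?_, ?_⟩
  · exact add_mem (add_mem (add_mem hp (Z.smul_mem _ (hpz z hz).2))
      (Z.smul_mem _ (hpz _ (hZ.star_mem z hz)).1))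
      (Z.smul_mem _ (hZ.mul_mul_mem hz hp (hZ.star_mem z hz)))
  · obtain ⟨s, rfl⟩ := CStarAlgebra.nonneg_iff_eq_mul_star_self.1 h0
    have : s * star s + t • (z * (s * star s)) + star t • (s * star s * star z) +
        (t * star t) • (z * (s * star s) * star z) =
        (s + t • (z * s)) * star (s + t • (z * s)) := by
      simp only [star_add, star_smul, star_mul, mul_add, add_mul, smul_mul_assoc, mul_smul_comm,
        mul_assoc]
      module
    rw [this]
    exact mul_star_self_nonneg _

lemma IsStarTRO.mul_mem_posSpan_right (hZ : IsStarTRO Z) {z j : B} (hz : z ∈ Z)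
    (hj : j ∈ posSpan Z) : j * z ∈ posSpan Z := by
  have := star_mem_posSpan (hZ.mul_mem_posSpan_left (hZ.star_mem z hz) (star_mem_posSpan hj))
  simpa using this

omit [StarOrderedRing B] in
lemma IsStarTRO.posSpan_le (hZ : IsStarTRO Z) : posSpan Z ≤ Z :=
  OrderedTRO.posSpan_le hZ.isClosed fun _ hb _ => hb

namespace IsSplitting

variable (h : IsSplitting Z V K)
include h

/-- The projection onto `V` is continuous, so `I ⊔ K`, the preimage of `I ⊆ V` in `Z`, is closed. -/
lemma isClosed_sup {I : Submodule ℂ B} (hI : I ≤ V) (hcl : IsClosed (I : Set B)) :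
    IsClosed ((I ⊔ K : Submodule ℂ B) : Set B) := by
  refine isClosed_of_closure_subset fun x hx => ?_
  have hle : ((I ⊔ K : Submodule ℂ B) : Set B) ⊆ Z :=
    sup_le (hI.trans h.left_le) h.right_le
  have hxZ : x ∈ Z := closure_minimal hle h.tro.isClosed hx
  obtain ⟨v, hv, hk⟩ := h.exists_sub_mem x hxZ
  have hvI : v ∈ closure (I : Set B) := by
    rw [Metric.mem_closure_iff] at hx ⊢
    intro ε hε
    obtain ⟨y, hy, hxy⟩ := hx ε hε
    obtain ⟨i, hi, k', hk', rfl⟩ := Submodule.mem_sup.1 hy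
    refine ⟨i, hi, lt_of_le_of_lt ?_ hxy⟩
    rw [dist_eq_norm, dist_eq_norm]
    have := h.norm_le_scalar (sub_mem hv (hI hi)) (sub_mem hk hk')
    have e : x - (i + k') = (v - i) + (x - v - k') := by abel
    rwa [e]
  rw [hcl.closure_eq] at hvI
  exact Submodule.mem_sup.2 ⟨v, hvI, x - v, hk, by abel⟩

lemma posSpan_left_le : posSpan V ≤ V := posSpan_le h.left_closed fun _ hb _ => hb

lemma posSpan_le_posSpan : posSpan V ≤ posSpan Z := posSpan_mono h.left_le

lemma isClosed_posSpan_sup : IsClosed ((posSpan V ⊔ K : Submodule ℂ B) : Set B) :=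
  h.isClosed_sup h.posSpan_left_le (isClosed_posSpan V)

/-- The projection onto `V` maps the positive elements of `Z` to positive elements of `V`. -/
lemma posSpan_le_sup : posSpan Z ≤ posSpan V ⊔ K := by
  refine posSpan_le h.isClosed_posSpan_sup fun p hp h0 => ?_
  obtain ⟨v, hv, hk⟩ := h.exists_sub_mem p hp
  have hv0 : 0 ≤ v := h.nonneg_scalar hv hk (by simpa using h0)
  exact Submodule.mem_sup.2 ⟨v, mem_posSpan_of_nonneg hv hv0, p - v, hk, by abel⟩

/-- A positive `a ∈ V` satisfies `a K, K a ⊆ K`, since `a a K, K a a ⊆ K`. -/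
lemma posSpan_le_mulInto : posSpan V ≤ mulInto K K := by
  refine posSpan_le (isClosed_mulInto h.right_closed) fun a ha h0 => ?_
  refine mem_of_mul_self_mem (isClosed_mulInto h.right_closed) (fun a ha b hb =>
    mul_mem_mulInto_self ha hb) (fun a ha => star_mem_mulInto h.right_star h.right_star ha) h0
    fun k hk => ⟨h.mul_mul_mem_right ha ha hk, ?_⟩
  rw [← mul_assoc]
  exact h.mul_mul_mem_left hk ha ha

/-- If the cube of `w ∈ V` is killed by the projection onto `V`, then `w = 0`: the elements
`w f(w* w)` are killed as well, and they approximate `w`. -/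
lemma eq_zero_of_cube_mem {w : B} (hw : w ∈ V) (hc : w * star w * w ∈ K) : w = 0 := by
  have hws := h.left_star w hw
  let S : Submodule ℂ B :=
    { carrier := {c | w * c ∈ K ∧ w * star c ∈ K ∧ c ∈ mulInto K K}
      add_mem' := fun {a b} ha hb => by
        refine ⟨?_, ?_, add_mem ha.2.2 hb.2.2⟩
        · rw [mul_add]; exact add_mem ha.1 hb.1
        · rw [star_add, mul_add]; exact add_mem ha.2.1 hb.2.1
      zero_mem' := by simp
      smul_mem' := fun t a ha => by
        refine ⟨?_, ?_, Submodule.smul_mem _ _ ha.2.2⟩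
        · rw [mul_smul_comm]; exact K.smul_mem _ ha.1
        · rw [star_smul, mul_smul_comm]; exact K.smul_mem _ ha.2.1 }
  have hScl : IsClosed (S : Set B) := by
    have : (S : Set B) = {c | w * c ∈ K} ∩ ({c | w * star c ∈ K} ∩ (mulInto K K : Set B)) := rfl
    rw [this]
    exact (h.right_closed.preimage (by fun_prop : Continuous fun c : B => w * c)).inter
      ((h.right_closed.preimage (by fun_prop : Continuous fun c : B => w * star c)).inter
        (isClosed_mulInto h.right_closed))
  have hSstar : ∀ a ∈ S, star a ∈ S := fun a ha =>
    ⟨ha.2.1, by rw [star_star]; exact ha.1, star_mem_mulInto h.right_star h.right_star ha.2.2⟩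
  have hSmul : ∀ a ∈ S, ∀ b ∈ S, a * b ∈ S := fun a ha b hb => by
    refine ⟨?_, ?_, mul_mem_mulInto_self ha.2.2 hb.2.2⟩
    · rw [← mul_assoc]; exact (hb.2.2 _ ha.1).2
    · rw [star_mul, ← mul_assoc]
      exact ((hSstar a ha).2.2 _ hb.2.1).2
  have hww : star w * w ∈ S := by
    refine ⟨by rwa [← mul_assoc], ?_, fun k hk => ⟨h.mul_mul_mem_right hws hw hk, ?_⟩⟩
    · rw [star_mul, star_star, ← mul_assoc]; exact hc
    · rw [← mul_assoc]; exact h.mul_mul_mem_left hk hws hw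
  refine norm_le_zero_iff.1 (le_of_forall_gt_imp_ge_of_dense fun r hr => ?_)
  have hm := (cfcₙ_mem_of_isClosed hScl hSmul hSstar (softCut r) hww).1
  have h1 := h.norm_le_scalar hw (neg_mem hm)
  rw [← sub_eq_add_neg] at h1
  exact h1.trans (norm_sub_softThreshold_le w hr)

/-- On the closed span of the positive elements, the kernel is invariant under multiplication by
`V`. -/
lemma left_le_mulInto_posSpan_inf : V ≤ mulInto (posSpan Z ⊓ K) (posSpan Z ⊓ K) := by
  have key : ∀ v ∈ V, ∀ k ∈ posSpan Z ⊓ K, v * k ∈ posSpan Z ⊓ K := by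
    rintro v hv k ⟨hkJ, hk⟩
    have hJ := h.tro.mul_mem_posSpan_left (h.left_le hv) hkJ
    refine ⟨hJ, ?_⟩
    obtain ⟨w, hw, k', hk', e⟩ := Submodule.mem_sup.1 (h.posSpan_le_sup hJ)
    have hws : star w ∈ posSpan V := star_mem_posSpan hw
    have hww : star w * w ∈ K := by
      have e' : star w * w = star w * v * k - star w * k' := by
        rw [mul_assoc, ← e]; noncomm_ring
      rw [e']
      exact sub_mem (h.mul_mul_mem_right (h.posSpan_left_le hws) hv hk)
        (h.posSpan_le_mulInto hws k' hk').1
    have hw0 : w = 0 := by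
      refine h.eq_zero_of_cube_mem (h.posSpan_left_le hw) ?_
      rw [mul_assoc]
      exact (h.posSpan_le_mulInto hw _ hww).1
    rwa [← e, hw0, zero_add]
  refine fun v hv k hk => ⟨key v hv k hk, ?_⟩
  have := key _ (h.left_star v hv) (star k) ⟨star_mem_posSpan hk.1, h.right_star k hk.2⟩
  have h2 := Submodule.mem_inf.2 ⟨star_mem_posSpan this.1, h.right_star _ this.2⟩
  simpa using h2

end IsSplitting
end Splitting

/-! ### The multiplier algebra and its two ideals -/

section Model

variable {B : Type u} [NonUnitalCStarAlgebra B] [PartialOrder B] [StarOrderedRing B]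
  {Z V K : Submodule ℂ B}

namespace IsSplitting

/-- The multipliers of the closed span of the positive elements that preserve the kernel of the
projection there. -/
noncomputable def orderMul (Z K : Submodule ℂ B) : Submodule ℂ B :=
  mulInto (posSpan Z) (posSpan Z) ⊓ mulInto (posSpan Z ⊓ K) (posSpan Z ⊓ K)

/-- The elements of `B` which multiply `V` into `posSpan V ⊔ K`: the even part of the ideal by which
the graded part of the model is divided. -/
noncomputable def evenIdeal (V K : Submodule ℂ B) : Submodule ℂ B := mulInto V (posSpan V ⊔ K)

/-- The even part of the graded multiplier algebra. -/
noncomputable def evenMul (Z V K : Submodule ℂ B) : Submodule ℂ B :=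
  mulInto Z Z ⊓ (mulInto (posSpan V ⊔ K) (posSpan V ⊔ K) ⊓
    mulInto (evenIdeal V K) (evenIdeal V K))

/-- The odd part of the graded multiplier algebra. -/
noncomputable def oddMul (Z V K : Submodule ℂ B) : Submodule ℂ B :=
  Z ⊓ (mulInto (posSpan V ⊔ K) (evenIdeal V K) ⊓ mulInto (evenIdeal V K) (posSpan V ⊔ K))

omit [StarOrderedRing B] in
lemma orderMul_mul_mem {x y : B} (hx : x ∈ orderMul Z K) (hy : y ∈ orderMul Z K) :
    x * y ∈ orderMul Z K :=
  ⟨mul_mem_mulInto_self hx.1 hy.1, mul_mem_mulInto_self hx.2 hy.2⟩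

omit [StarOrderedRing B] in
lemma evenMul_mul_evenMul {x y : B} (hx : x ∈ evenMul Z V K) (hy : y ∈ evenMul Z V K) :
    x * y ∈ evenMul Z V K :=
  ⟨mul_mem_mulInto_self hx.1 hy.1, mul_mem_mulInto_self hx.2.1 hy.2.1,
    mul_mem_mulInto_self hx.2.2 hy.2.2⟩

omit [StarOrderedRing B] in
lemma evenMul_mul_oddMul {x y : B} (hx : x ∈ evenMul Z V K) (hy : y ∈ oddMul Z V K) :
    x * y ∈ oddMul Z V K :=
  ⟨(hx.1 y hy.1).1, mul_mem_mulInto hx.2.1 hx.2.2 hy.2.1 hy.2.1,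
    mul_mem_mulInto hx.2.2 hx.2.1 hy.2.2 hy.2.2⟩

omit [StarOrderedRing B] in
lemma oddMul_mul_evenMul {x y : B} (hx : x ∈ oddMul Z V K) (hy : y ∈ evenMul Z V K) :
    x * y ∈ oddMul Z V K :=
  ⟨(hy.1 x hx.1).2, mul_mem_mulInto hx.2.1 hx.2.1 hy.2.1 hy.2.2,
    mul_mem_mulInto hx.2.2 hx.2.2 hy.2.2 hy.2.1⟩

section

variable (h : IsSplitting Z V K)
include h

lemma star_mem_posSpan_sup : ∀ x ∈ posSpan V ⊔ K, star x ∈ posSpan V ⊔ K := by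
  intro x hx
  obtain ⟨i, hi, k, hk, rfl⟩ := Submodule.mem_sup.1 hx
  rw [star_add]
  exact Submodule.mem_sup.2 ⟨_, star_mem_posSpan hi, _, h.right_star k hk, rfl⟩

lemma star_mem_evenIdeal : ∀ x ∈ evenIdeal V K, star x ∈ evenIdeal V K :=
  fun _ hx => star_mem_mulInto h.left_star h.star_mem_posSpan_sup hx

lemma star_mem_inf : ∀ x ∈ posSpan Z ⊓ K, star x ∈ posSpan Z ⊓ K :=
  fun x hx => ⟨star_mem_posSpan hx.1, h.right_star x hx.2⟩

lemma isClosed_inf : IsClosed ((posSpan Z ⊓ K : Submodule ℂ B) : Set B) :=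
  (isClosed_posSpan Z).inter h.right_closed

lemma isClosed_evenIdeal : IsClosed (evenIdeal V K : Set B) :=
  isClosed_mulInto h.isClosed_posSpan_sup

lemma isClosed_orderMul : IsClosed (orderMul Z K : Set B) :=
  (isClosed_mulInto (isClosed_posSpan Z)).inter (isClosed_mulInto h.isClosed_inf)

lemma isClosed_evenMul : IsClosed (evenMul Z V K : Set B) :=
  (isClosed_mulInto h.tro.isClosed).inter
    ((isClosed_mulInto h.isClosed_posSpan_sup).inter (isClosed_mulInto h.isClosed_evenIdeal))

lemma isClosed_oddMul : IsClosed (oddMul Z V K : Set B) :=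
  h.tro.isClosed.inter
    ((isClosed_mulInto h.isClosed_evenIdeal).inter (isClosed_mulInto h.isClosed_posSpan_sup))

lemma left_le_orderMul : V ≤ orderMul Z K := fun _ hv =>
  ⟨fun _ hj => ⟨h.tro.mul_mem_posSpan_left (h.left_le hv) hj,
    h.tro.mul_mem_posSpan_right (h.left_le hv) hj⟩, h.left_le_mulInto_posSpan_inf hv⟩

/-- `V` consists of odd multipliers: for `v, w ∈ V` and `i ∈ posSpan V` all products of `v, w, i`
lie in `posSpan Z ≤ posSpan V ⊔ K`, and for `k ∈ K` all products of `v, w, k` lie in `K`. -/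
lemma left_le_oddMul : V ≤ oddMul Z V K := by
  intro v hv
  have hJ : ∀ {a}, a ∈ posSpan V → a ∈ posSpan Z := fun ha => h.posSpan_le_posSpan ha
  have hL : ∀ {a}, a ∈ posSpan Z → a ∈ posSpan V ⊔ K := fun ha => h.posSpan_le_sup ha
  have hK : ∀ {a}, a ∈ K → a ∈ posSpan V ⊔ K := fun ha => Submodule.mem_sup_right ha
  refine ⟨h.left_le hv, fun l hl => ?_, fun c hc => (hc v hv).symm⟩
  obtain ⟨i, hi, k, hk, rfl⟩ := Submodule.mem_sup.1 hl
  have hl : ∀ {a b}, a ∈ V → b ∈ V → a * b * i ∈ posSpan V ⊔ K := fun ha hb => by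
    rw [mul_assoc]
    exact hL (h.tro.mul_mem_posSpan_left (h.left_le ha)
      (h.tro.mul_mem_posSpan_left (h.left_le hb) (hJ hi)))
  have hr : ∀ {a b}, a ∈ V → b ∈ V → i * a * b ∈ posSpan V ⊔ K := fun ha hb =>
    hL (h.tro.mul_mem_posSpan_right (h.left_le hb)
      (h.tro.mul_mem_posSpan_right (h.left_le ha) (hJ hi)))
  have hm : ∀ {a b}, a ∈ V → b ∈ V → a * i * b ∈ posSpan V ⊔ K := fun ha hb =>
    hL (h.tro.mul_mem_posSpan_right (h.left_le hb)
      (h.tro.mul_mem_posSpan_left (h.left_le ha) (hJ hi)))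
  refine ⟨fun w hw => ⟨?_, ?_⟩, fun w hw => ⟨?_, ?_⟩⟩
  · rw [mul_add, add_mul]
    exact add_mem (hm hv hw) (hK (h.mul_mul_mem_mid hv hk hw))
  · rw [← mul_assoc, mul_add]
    exact add_mem (hl hw hv) (hK (h.mul_mul_mem_right hw hv hk))
  · rw [add_mul, add_mul]
    exact add_mem (hr hv hw) (hK (h.mul_mul_mem_left hk hv hw))
  · rw [← mul_assoc, mul_add, add_mul]
    exact add_mem (hm hw hv) (hK (h.mul_mul_mem_mid hw hk hv))

lemma oddMul_mul_oddMul {x y : B} (hx : x ∈ oddMul Z V K) (hy : y ∈ oddMul Z V K) :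
    x * y ∈ evenMul Z V K :=
  ⟨fun z hz => ⟨h.tro.mul_mul_mem hx.1 hy.1 hz, by
      rw [← mul_assoc]; exact h.tro.mul_mul_mem hz hx.1 hy.1⟩,
    mul_mem_mulInto hx.2.1 hx.2.2 hy.2.1 hy.2.2, mul_mem_mulInto hx.2.2 hx.2.1 hy.2.2 hy.2.1⟩

end

/-- The C*-algebra of triples `(x, y, z)`, with `x` a multiplier of the closed span of the positive
elements, and `y = e + o`, `z = e - o` encoding an element `e ⊕ o` of the `ℤ/2`-graded multiplier
algebra. -/
def alg (h : IsSplitting Z V K) : NonUnitalStarSubalgebra ℂ (B × B × B) where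
  carrier := {x | x.1 ∈ orderMul Z K ∧ x.2.1 + x.2.2 ∈ evenMul Z V K ∧
    x.2.1 - x.2.2 ∈ oddMul Z V K}
  add_mem' := fun {a b} ha hb => by
    refine ⟨add_mem ha.1 hb.1, ?_, ?_⟩
    · have := add_mem ha.2.1 hb.2.1
      rwa [add_add_add_comm] at this
    · have := add_mem ha.2.2 hb.2.2
      rwa [← add_sub_add_comm] at this
  zero_mem' := by simp
  smul_mem' := fun t a ha => by
    refine ⟨Submodule.smul_mem _ t ha.1, ?_, ?_⟩
    · have := Submodule.smul_mem _ t ha.2.1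
      rwa [smul_add] at this
    · have := Submodule.smul_mem _ t ha.2.2
      rwa [smul_sub] at this
  mul_mem' := fun {a b} ha hb => by
    refine ⟨orderMul_mul_mem ha.1 hb.1, ?_, ?_⟩
    · have := Submodule.smul_mem _ (2⁻¹ : ℂ) (add_mem (evenMul_mul_evenMul ha.2.1 hb.2.1)
        (h.oddMul_mul_oddMul ha.2.2 hb.2.2))
      convert this using 1
      simp only [Prod.fst_mul, Prod.snd_mul, mul_add, add_mul, mul_sub, sub_mul]
      module
    · have := Submodule.smul_mem _ (2⁻¹ : ℂ) (add_mem (evenMul_mul_oddMul ha.2.1 hb.2.2)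
        (oddMul_mul_evenMul ha.2.2 hb.2.1))
      convert this using 1
      simp only [Prod.fst_mul, Prod.snd_mul, mul_add, add_mul, mul_sub, sub_mul]
      module
  star_mem' := fun {a} ha => by
    refine ⟨⟨?_, ?_⟩, ⟨?_, ?_, ?_⟩, ⟨?_, ?_, ?_⟩⟩
    · exact star_mem_mulInto (fun _ => star_mem_posSpan) (fun _ => star_mem_posSpan) ha.1.1
    · exact star_mem_mulInto h.star_mem_inf h.star_mem_inf ha.1.2
    · have := star_mem_mulInto h.tro.star_mem h.tro.star_mem ha.2.1.1
      rwa [star_add] at this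
    · have := star_mem_mulInto h.star_mem_posSpan_sup h.star_mem_posSpan_sup ha.2.1.2.1
      rwa [star_add] at this
    · have := star_mem_mulInto h.star_mem_evenIdeal h.star_mem_evenIdeal ha.2.1.2.2
      rwa [star_add] at this
    · have := h.tro.star_mem _ ha.2.2.1
      rwa [star_sub] at this
    · have := star_mem_mulInto h.star_mem_posSpan_sup h.star_mem_evenIdeal ha.2.2.2.1
      rwa [star_sub] at this
    · have := star_mem_mulInto h.star_mem_evenIdeal h.star_mem_posSpan_sup ha.2.2.2.2
      rwa [star_sub] at this

lemma isClosed_alg (h : IsSplitting Z V K) : IsClosed (h.alg : Set (B × B × B)) := by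
  have : (h.alg : Set (B × B × B)) = (fun x => x.1) ⁻¹' (orderMul Z K : Set B) ∩
      ((fun x => x.2.1 + x.2.2) ⁻¹' (evenMul Z V K : Set B) ∩
        (fun x => x.2.1 - x.2.2) ⁻¹' (oddMul Z V K : Set B)) := rfl
  rw [this]
  exact (h.isClosed_orderMul.preimage (by fun_prop)).inter
    ((h.isClosed_evenMul.preimage (by fun_prop)).inter (h.isClosed_oddMul.preimage (by fun_prop)))

/-- The algebra `h.alg` as a type; it carries its spectral order. -/
def Alg (h : IsSplitting Z V K) : Type u := h.alg

noncomputable instance (h : IsSplitting Z V K) : NonUnitalCStarAlgebra h.Alg :=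
  NonUnitalStarSubalgebra.nonUnitalCStarAlgebra h.alg (h_closed := h.isClosed_alg)

noncomputable instance (h : IsSplitting Z V K) : PartialOrder h.Alg :=
  CStarAlgebra.spectralOrder _

instance (h : IsSplitting Z V K) : StarOrderedRing h.Alg := CStarAlgebra.spectralOrderedRing _

variable (h : IsSplitting Z V K)

/-- The inclusion of `h.alg` into `B × B × B`. -/
noncomputable def incl : h.Alg →⋆ₙₐ[ℂ] B × B × B := NonUnitalStarSubalgebraClass.subtype h.alg

/-- The first coordinate of `h.alg`. -/
noncomputable def coord₁ : h.Alg →⋆ₙₐ[ℂ] B := (NonUnitalStarAlgHom.fst ℂ B (B × B)).comp h.incl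

/-- The second coordinate of `h.alg`. -/
noncomputable def coord₂ : h.Alg →⋆ₙₐ[ℂ] B :=
  ((NonUnitalStarAlgHom.fst ℂ B B).comp (NonUnitalStarAlgHom.snd ℂ B (B × B))).comp h.incl

/-- The third coordinate of `h.alg`. -/
noncomputable def coord₃ : h.Alg →⋆ₙₐ[ℂ] B :=
  ((NonUnitalStarAlgHom.snd ℂ B B).comp (NonUnitalStarAlgHom.snd ℂ B (B × B))).comp h.incl

lemma alg_ext {x y : h.Alg} (h₁ : h.coord₁ x = h.coord₁ y) (h₂ : h.coord₂ x = h.coord₂ y)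
    (h₃ : h.coord₃ x = h.coord₃ y) : x = y :=
  Subtype.ext (Prod.ext h₁ (Prod.ext h₂ h₃))

lemma coord_mem (x : h.Alg) : h.coord₁ x ∈ orderMul Z K ∧
    h.coord₂ x + h.coord₃ x ∈ evenMul Z V K ∧ h.coord₂ x - h.coord₃ x ∈ oddMul Z V K := x.2

/-- The exchange of the last two coordinates, that is, the grading automorphism. -/
noncomputable def flip : h.Alg →⋆ₙₐ[ℂ] h.Alg where
  toFun x := ⟨(h.coord₁ x, h.coord₃ x, h.coord₂ x), (h.coord_mem x).1, by
    have := (h.coord_mem x).2.1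
    rwa [add_comm] at this, by
    have := neg_mem (h.coord_mem x).2.2
    rwa [neg_sub] at this⟩
  map_smul' _ _ := rfl
  map_zero' := rfl
  map_add' _ _ := rfl
  map_mul' _ _ := rfl
  map_star' _ := rfl

/-- The ideal of elements whose first coordinate maps the closed span of the positive elements into
the kernel of the projection. -/
noncomputable def orderIdeal : ClosedStarIdeal h.Alg where
  carrier := {x | h.coord₁ x ∈ mulInto (posSpan Z) (posSpan Z ⊓ K)}
  add_mem' {a b} ha hb := by
    have : h.coord₁ a + h.coord₁ b ∈ mulInto (posSpan Z) (posSpan Z ⊓ K) := add_mem ha hb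
    rwa [← map_add] at this
  zero_mem' := by simp
  smul_mem' t a ha := by
    have : t • h.coord₁ a ∈ mulInto (posSpan Z) (posSpan Z ⊓ K) := Submodule.smul_mem _ t ha
    rwa [← map_smul] at this
  isClosed' := (isClosed_mulInto h.isClosed_inf).preimage
    (continuous_fst.comp continuous_subtype_val)
  mul_mem_left' a n hn := by
    have := mul_mem_mulInto (h.coord_mem a).1.1 (h.coord_mem a).1.2 hn hn
    rwa [← map_mul] at this
  mul_mem_right' a n hn := by
    have := mul_mem_mulInto hn hn (h.coord_mem a).1.1 (h.coord_mem a).1.2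
    rwa [← map_mul] at this
  star_mem' {n} hn := by
    have := star_mem_mulInto (fun _ => star_mem_posSpan) h.star_mem_inf hn
    rwa [← map_star] at this

/-- The graded ideal with even part `evenIdeal V K` and odd part `posSpan V ⊔ K`. -/
noncomputable def gradedIdeal : ClosedStarIdeal h.Alg where
  carrier := {x | h.coord₂ x + h.coord₃ x ∈ evenIdeal V K ∧
    h.coord₂ x - h.coord₃ x ∈ posSpan V ⊔ K}
  add_mem' {a b} ha hb := by
    refine ⟨?_, ?_⟩
    · have := add_mem ha.1 hb.1
      rwa [add_add_add_comm, ← map_add, ← map_add] at this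
    · have := add_mem ha.2 hb.2
      rwa [← add_sub_add_comm, ← map_add, ← map_add] at this
  zero_mem' := by simp
  smul_mem' t a ha := by
    refine ⟨?_, ?_⟩
    · have := Submodule.smul_mem _ t ha.1
      rwa [smul_add, ← map_smul, ← map_smul] at this
    · have := Submodule.smul_mem _ t ha.2
      rwa [smul_sub, ← map_smul, ← map_smul] at this
  isClosed' := by
    have h2 : Continuous h.coord₂ :=
      (continuous_fst.comp continuous_snd).comp continuous_subtype_val
    have h3 : Continuous h.coord₃ :=
      (continuous_snd.comp continuous_snd).comp continuous_subtype_val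
    exact (h.isClosed_evenIdeal.preimage (h2.add h3)).inter
      (h.isClosed_posSpan_sup.preimage (h2.sub h3))
  mul_mem_left' a n hn := by
    obtain ⟨-, he, ho⟩ := h.coord_mem a
    refine ⟨?_, ?_⟩
    · have := Submodule.smul_mem _ (2⁻¹ : ℂ) (add_mem (he.2.2 _ hn.1).1 (ho.2.1 _ hn.2).1)
      convert this using 1
      simp only [map_mul, mul_add, add_mul, mul_sub, sub_mul]
      module
    · have := Submodule.smul_mem _ (2⁻¹ : ℂ) (add_mem (he.2.1 _ hn.2).1 (ho.2.2 _ hn.1).1)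
      convert this using 1
      simp only [map_mul, mul_add, add_mul, mul_sub, sub_mul]
      module
  mul_mem_right' a n hn := by
    obtain ⟨-, he, ho⟩ := h.coord_mem a
    refine ⟨?_, ?_⟩
    · have := Submodule.smul_mem _ (2⁻¹ : ℂ) (add_mem (he.2.2 _ hn.1).2 (ho.2.1 _ hn.2).2)
      convert this using 1
      simp only [map_mul, mul_add, add_mul, mul_sub, sub_mul]
      module
    · have := Submodule.smul_mem _ (2⁻¹ : ℂ) (add_mem (he.2.1 _ hn.2).2 (ho.2.2 _ hn.1).2)
      convert this using 1
      simp only [map_mul, mul_add, add_mul, mul_sub, sub_mul]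
      module
  star_mem' {n} hn := by
    refine ⟨?_, ?_⟩
    · have := h.star_mem_evenIdeal _ hn.1
      rwa [star_add, ← map_star, ← map_star] at this
    · have := h.star_mem_posSpan_sup _ hn.2
      rwa [star_sub, ← map_star, ← map_star] at this

end IsSplitting
end Model

/-! ### The model -/

section Model

variable {B : Type u} [NonUnitalCStarAlgebra B] [PartialOrder B] [StarOrderedRing B]
  {Z V K : Submodule ℂ B}

noncomputable instance {A : Type u} [NonUnitalCStarAlgebra A] (N : ClosedStarIdeal A) :
    PartialOrder N.Quotient := CStarAlgebra.spectralOrder _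

instance {A : Type u} [NonUnitalCStarAlgebra A] (N : ClosedStarIdeal A) :
    StarOrderedRing N.Quotient := CStarAlgebra.spectralOrderedRing _

namespace IsSplitting

variable (h : IsSplitting Z V K)

/-- The C*-algebra that contains the model of `V`. The graded quotient occurs twice: an element
`v` of `V` gives `a` in the first copy and `-a` in the second one, so that no information about
positivity comes from there. -/
def Target : Type u :=
  h.orderIdeal.Quotient × h.gradedIdeal.Quotient × h.gradedIdeal.Quotient

noncomputable instance : NonUnitalCStarAlgebra h.Target :=
  inferInstanceAs (NonUnitalCStarAlgebra
    (h.orderIdeal.Quotient × h.gradedIdeal.Quotient × h.gradedIdeal.Quotient))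

noncomputable instance : PartialOrder h.Target := CStarAlgebra.spectralOrder _

instance : StarOrderedRing h.Target := CStarAlgebra.spectralOrderedRing _

/-- The quotient by `h.orderIdeal`. -/
noncomputable def orderHom : h.Alg →⋆ₙₐ[ℂ] h.orderIdeal.Quotient := h.orderIdeal.quotHom

/-- The quotient by `h.gradedIdeal`. -/
noncomputable def gradedHom : h.Alg →⋆ₙₐ[ℂ] h.gradedIdeal.Quotient := h.gradedIdeal.quotHom

/-- The first coordinate of the target. -/
noncomputable def target₁ : h.Target →⋆ₙₐ[ℂ] h.orderIdeal.Quotient :=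
  NonUnitalStarAlgHom.fst ℂ h.orderIdeal.Quotient (h.gradedIdeal.Quotient × h.gradedIdeal.Quotient)

/-- The second coordinate of the target. -/
noncomputable def target₂ : h.Target →⋆ₙₐ[ℂ] h.gradedIdeal.Quotient :=
  (NonUnitalStarAlgHom.fst ℂ h.gradedIdeal.Quotient h.gradedIdeal.Quotient).comp
    (NonUnitalStarAlgHom.snd ℂ h.orderIdeal.Quotient
      (h.gradedIdeal.Quotient × h.gradedIdeal.Quotient))

/-- The third coordinate of the target. -/
noncomputable def target₃ : h.Target →⋆ₙₐ[ℂ] h.gradedIdeal.Quotient :=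
  (NonUnitalStarAlgHom.snd ℂ h.gradedIdeal.Quotient h.gradedIdeal.Quotient).comp
    (NonUnitalStarAlgHom.snd ℂ h.orderIdeal.Quotient
      (h.gradedIdeal.Quotient × h.gradedIdeal.Quotient))

/-- The `*`-homomorphism whose restriction to the elements `(v, v, -v)`, `v ∈ V`, is the model. -/
noncomputable def modelHom : h.Alg →⋆ₙₐ[ℂ] h.Target :=
  NonUnitalStarAlgHom.prod h.orderHom
    (NonUnitalStarAlgHom.prod h.gradedHom (h.gradedHom.comp h.flip))

lemma target₁_modelHom (x : h.Alg) : h.target₁ (h.modelHom x) = h.orderHom x := rfl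

lemma target₂_modelHom (x : h.Alg) : h.target₂ (h.modelHom x) = h.gradedHom x := rfl

lemma target₃_modelHom (x : h.Alg) : h.target₃ (h.modelHom x) = h.gradedHom (h.flip x) := rfl

lemma modelHom_eq_zero_iff {x : h.Alg} :
    h.modelHom x = 0 ↔ h.orderHom x = 0 ∧ h.gradedHom x = 0 ∧ h.gradedHom (h.flip x) = 0 := by
  constructor
  · intro hx
    rw [← target₁_modelHom, ← target₂_modelHom, ← target₃_modelHom, hx]
    simp
  · rintro ⟨h1, h2, h3⟩
    exact Prod.ext h1 (Prod.ext h2 h3)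

lemma orderHom_eq_zero_iff {x : h.Alg} :
    h.orderHom x = 0 ↔ h.coord₁ x ∈ mulInto (posSpan Z) (posSpan Z ⊓ K) :=
  h.orderIdeal.quotHom_eq_zero

lemma gradedHom_eq_zero_iff {x : h.Alg} : h.gradedHom x = 0 ↔
    h.coord₂ x + h.coord₃ x ∈ evenIdeal V K ∧ h.coord₂ x - h.coord₃ x ∈ posSpan V ⊔ K :=
  h.gradedIdeal.quotHom_eq_zero

/-- The copy of `V` in `h.alg`. -/
noncomputable def embed : V →ₗ[ℂ] h.Alg where
  toFun v := ⟨((v : B), (v : B), -(v : B)), h.left_le_orderMul v.2, by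
    change (v : B) + -(v : B) ∈ _
    rw [add_neg_cancel]; exact zero_mem _, by
    change (v : B) - -(v : B) ∈ _
    rw [sub_neg_eq_add]; exact add_mem (h.left_le_oddMul v.2) (h.left_le_oddMul v.2)⟩
  map_add' x y := by
    refine h.alg_ext rfl rfl ?_
    change -((x : B) + y) = -(x : B) + -(y : B)
    abel
  map_smul' t x := by
    refine h.alg_ext rfl rfl ?_
    change -(t • (x : B)) = t • -(x : B)
    rw [smul_neg]

lemma coord₁_embed (v : V) : h.coord₁ (h.embed v) = v := rfl
lemma coord₂_embed (v : V) : h.coord₂ (h.embed v) = v := rfl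
lemma coord₃_embed (v : V) : h.coord₃ (h.embed v) = -v := rfl
lemma coord₂_flip (x : h.Alg) : h.coord₂ (h.flip x) = h.coord₃ x := rfl
lemma coord₃_flip (x : h.Alg) : h.coord₃ (h.flip x) = h.coord₂ x := rfl

/-- On the elements `(z, z, -z)` the graded quotient sees exactly the class of `z` modulo
`posSpan V ⊔ K`. -/
lemma gradedHom_eq_zero_iff_of_odd {x : h.Alg} (h₃ : h.coord₃ x = -h.coord₂ x) :
    h.gradedHom x = 0 ↔ h.coord₂ x ∈ posSpan V ⊔ K := by
  rw [gradedHom_eq_zero_iff, h₃, add_neg_cancel, sub_neg_eq_add, ← two_smul ℂ,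
    Submodule.smul_mem_iff _ two_ne_zero]
  exact and_iff_right (zero_mem _)

include h in
/-- A multiplier `k ∈ K` of the closed span of the positive elements maps that span into `K`: this
holds on `posSpan V` by `posSpan_le_mulInto`, and on `posSpan Z ⊓ K` because `k` is a multiplier. -/
lemma mem_mulInto_of_mem_right {k : B} (hk : k ∈ K) (hm : k ∈ orderMul Z K) :
    k ∈ mulInto (posSpan Z) (posSpan Z ⊓ K) := by
  intro j hj
  obtain ⟨i, hi, k', hk', rfl⟩ := Submodule.mem_sup.1 (h.posSpan_le_sup hj)
  have hiJ := h.posSpan_le_posSpan hi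
  have hk'J : k' ∈ posSpan Z ⊓ K := ⟨by simpa using sub_mem hj hiJ, hk'⟩
  have hiK := h.posSpan_le_mulInto hi k hk
  rw [mul_add, add_mul]
  exact ⟨add_mem ⟨h.tro.mul_mem_posSpan_left (h.right_le hk) hiJ, hiK.2⟩ (hm.2 _ hk'J).1,
    add_mem ⟨h.tro.mul_mem_posSpan_right (h.right_le hk) hiJ, hiK.1⟩ (hm.2 _ hk'J).2⟩

include h in
/-- The converse, for elements of `posSpan V ⊔ K`: the component `w` in `posSpan V` satisfies
`w w* ∈ K`, whence `w = 0`. -/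
lemma mem_right_of_mem_mulInto {z : B} (hz : z ∈ orderMul Z K)
    (h0 : z ∈ mulInto (posSpan Z) (posSpan Z ⊓ K)) (hL : z ∈ posSpan V ⊔ K) : z ∈ K := by
  obtain ⟨w, hw, k, hk, rfl⟩ := Submodule.mem_sup.1 hL
  have hwV := h.posSpan_left_le hw
  have hkm : k ∈ orderMul Z K := by simpa using sub_mem hz (h.left_le_orderMul hwV)
  have hw0 : w ∈ mulInto (posSpan Z) (posSpan Z ⊓ K) := by
    simpa using sub_mem h0 (h.mem_mulInto_of_mem_right hk hkm)
  have hww : w * star w ∈ K := (hw0 _ (star_mem_posSpan (h.posSpan_le_posSpan hw))).1.2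
  rw [h.eq_zero_of_cube_mem hwV (h.posSpan_le_mulInto hw _ hww).2, zero_add]
  exact hk

/-- On the elements `(z, z, -z)` the kernel of the model is the kernel of the projection. -/
lemma modelHom_eq_zero_iff_of_odd {x : h.Alg} (h₂ : h.coord₂ x = h.coord₁ x)
    (h₃ : h.coord₃ x = -h.coord₁ x) : h.modelHom x = 0 ↔ h.coord₁ x ∈ K := by
  have hodd : h.coord₃ x = -h.coord₂ x := by rw [h₂, h₃]
  rw [modelHom_eq_zero_iff, orderHom_eq_zero_iff, h.gradedHom_eq_zero_iff_of_odd hodd,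
    h.gradedHom_eq_zero_iff_of_odd (x := h.flip x)
      (by rw [coord₃_flip, coord₂_flip, hodd, neg_neg]), coord₂_flip, h₃, h₂, neg_mem_iff, and_self]
  exact ⟨fun hx => h.mem_right_of_mem_mulInto (h.coord_mem x).1 hx.1 hx.2, fun hx =>
    ⟨h.mem_mulInto_of_mem_right hx (h.coord_mem x).1, Submodule.mem_sup_right hx⟩⟩

lemma modelHom_embed_eq_zero_iff {v : V} : h.modelHom (h.embed v) = 0 ↔ v = 0 := by
  rw [h.modelHom_eq_zero_iff_of_odd rfl rfl, coord₁_embed]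
  refine ⟨fun hv => Subtype.ext (h.eq_zero_of_mem v.2 hv), ?_⟩
  rintro rfl
  exact zero_mem _

end IsSplitting

/-! ### Matrices over the model -/

/-- The amplification of a `*`-homomorphism to `n × n` matrices. -/
noncomputable def amp {A : Type u} [NonUnitalCStarAlgebra A] {A' : Type v}
    [NonUnitalCStarAlgebra A'] (n : ℕ) (φ : A →⋆ₙₐ[ℂ] A') :
    CStarMatrix (Fin n) (Fin n) A →⋆ₙₐ[ℂ] CStarMatrix (Fin n) (Fin n) A' :=
  CStarMatrix.mapₙₐ φ

/-- The matrices with entries in `S`. -/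
def matrixSubmodule (n : ℕ) (S : Submodule ℂ B) : Submodule ℂ (CStarMatrix (Fin n) (Fin n) B) where
  carrier := {M | ∀ i j, M i j ∈ S}
  add_mem' := fun ha hb i j => add_mem (ha i j) (hb i j)
  zero_mem' := fun _ _ => zero_mem _
  smul_mem' := fun t _ ha i j => S.smul_mem t (ha i j)

omit [PartialOrder B] [StarOrderedRing B] in
lemma isClosed_matrixSubmodule (n : ℕ) {S : Submodule ℂ B} (hS : IsClosed (S : Set B)) :
    IsClosed (matrixSubmodule n S : Set (CStarMatrix (Fin n) (Fin n) B)) := by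
  have : (matrixSubmodule n S : Set (CStarMatrix (Fin n) (Fin n) B)) =
      ⋂ i, ⋂ j, (fun M : CStarMatrix (Fin n) (Fin n) B => M i j) ⁻¹' (S : Set B) := by
    ext M
    simp only [Set.mem_iInter]
    exact Iff.rfl
  rw [this]
  exact isClosed_iInter fun i => isClosed_iInter fun j =>
    hS.preimage ((continuous_apply j).comp (continuous_apply i))

lemma IsStarTRO.negPart_entry_mem_posSpan (hZ : IsStarTRO Z) {n : ℕ}
    {v : CStarMatrix (Fin n) (Fin n) B} (hv : ∀ i j, v i j ∈ posSpan Z) (i j : Fin n) :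
    negPart v i j ∈ posSpan Z := by
  have key : negPart v ∈ matrixSubmodule n (posSpan Z) := by
    refine negPart_mem_of_isClosed (isClosed_matrixSubmodule n (isClosed_posSpan Z)) ?_ ?_ hv
    · intro a ha b hb i j
      rw [CStarMatrix.mul_apply]
      exact sum_mem fun k _ => hZ.mul_mem_posSpan_left (hZ.posSpan_le (ha i k)) (hb k j)
    · intro a ha i j
      exact star_mem_posSpan (ha j i)
  exact key i j

namespace IsSplitting

variable (h : IsSplitting Z V K) {n : ℕ} {X : CStarMatrix (Fin n) (Fin n) h.Alg}
  {v : CStarMatrix (Fin n) (Fin n) B}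

/-- The model is completely isometric. For `r > ‖T v‖`, soft thresholding at `r` sends
`x = (v, v, -v)` to an element `(z, z, -z)` annihilated by the model, so that `z` lies in the kernel
of the projection, while `‖v - z‖ ≤ r`. -/
lemma norm_amp_modelHom (h₁ : amp n h.coord₁ X = v) (h₂ : amp n h.coord₂ X = v)
    (h₃ : amp n h.coord₃ X = -v) (hv : ∀ i j, v i j ∈ V) :
    ‖amp n h.modelHom X‖ = ‖v‖ := by
  apply le_antisymm
  · have hX : ‖X‖ ≤ ‖v‖ := by
      refine le_of_forall_gt_imp_ge_of_dense fun r hr => ?_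
      have hr0 : 0 < r := (norm_nonneg _).trans_lt hr
      have e : softThreshold r X = 0 := by
        have e1 : amp n h.coord₁ (softThreshold r X) = 0 := by
          rw [map_softThreshold _ _ hr0, h₁, softThreshold_eq_zero hr0 hr.le]
        have e2 : amp n h.coord₂ (softThreshold r X) = 0 := by
          rw [map_softThreshold _ _ hr0, h₂, softThreshold_eq_zero hr0 hr.le]
        have e3 : amp n h.coord₃ (softThreshold r X) = 0 := by
          rw [map_softThreshold _ _ hr0, h₃, softThreshold_neg, softThreshold_eq_zero hr0 hr.le,
            neg_zero]
        ext i j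
        exact h.alg_ext (congrFun (congrFun e1 i) j) (congrFun (congrFun e2 i) j)
          (congrFun (congrFun e3 i) j)
      have := norm_sub_softThreshold_le X hr0
      rwa [e, sub_zero] at this
    exact (NonUnitalStarAlgHom.norm_apply_le _ _).trans hX
  · refine le_of_forall_gt_imp_ge_of_dense fun r hr => ?_
    have hr0 : 0 < r := (norm_nonneg _).trans_lt hr
    have c1 := map_softThreshold (amp n h.coord₁) X hr0
    have c2 := map_softThreshold (amp n h.coord₂) X hr0
    have c3 := map_softThreshold (amp n h.coord₃) X hr0
    have e := map_softThreshold (amp n h.modelHom) X hr0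
    rw [softThreshold_eq_zero hr0 hr.le] at e
    rw [h₁] at c1
    rw [h₂] at c2
    rw [h₃, softThreshold_neg] at c3
    have hvr := norm_sub_softThreshold_le v hr0
    generalize softThreshold r X = Y at *
    generalize softThreshold r v = z at *
    have hz : ∀ i j, z i j ∈ K := by
      intro i j
      have d1 : h.coord₁ (Y i j) = z i j := congrFun (congrFun c1 i) j
      have d2 : h.coord₂ (Y i j) = z i j := congrFun (congrFun c2 i) j
      have d3 : h.coord₃ (Y i j) = -z i j := congrFun (congrFun c3 i) j
      have := (h.modelHom_eq_zero_iff_of_odd (x := Y i j) (by rw [d1, d2]) (by rw [d1, d3])).1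
        (congrFun (congrFun e i) j)
      rwa [d1] at this
    have := h.norm_le n v (-z) hv fun i j => neg_mem (hz i j)
    rw [← sub_eq_add_neg] at this
    exact this.trans hvr

lemma isSelfAdjoint_of_coord (h₁ : amp n h.coord₁ X = v) (h₂ : amp n h.coord₂ X = v)
    (h₃ : amp n h.coord₃ X = -v) (hv : IsSelfAdjoint v) : IsSelfAdjoint X := by
  have hv' : star v = v := hv
  have e1 : amp n h.coord₁ (star X) = amp n h.coord₁ X := by rw [map_star, h₁, hv']
  have e2 : amp n h.coord₂ (star X) = amp n h.coord₂ X := by rw [map_star, h₂, hv']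
  have e3 : amp n h.coord₃ (star X) = amp n h.coord₃ X := by rw [map_star, h₃, star_neg, hv']
  ext i j
  exact h.alg_ext (congrFun (congrFun e1 i) j) (congrFun (congrFun e2 i) j)
    (congrFun (congrFun e3 i) j)

/-- The model is completely positive: the entries of a positive matrix lie in `posSpan V`, on which
only the ungraded quotient is nonzero. -/
lemma amp_modelHom_nonneg (h₁ : amp n h.coord₁ X = v) (h₂ : amp n h.coord₂ X = v)
    (h₃ : amp n h.coord₃ X = -v) (hv : ∀ i j, v i j ∈ V) (h0 : 0 ≤ v) :
    0 ≤ amp n h.modelHom X := by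
  have hX := h.isSelfAdjoint_of_coord h₁ h₂ h₃ (.of_nonneg h0)
  have hI : ∀ i j, v i j ∈ posSpan V := fun i j =>
    span_posCone_le_posSpan V (entry_mem_span_posCone hv h0 i j)
  have d2 : ∀ i j, h.coord₂ (X i j) = v i j := fun i j => congrFun (congrFun h₂ i) j
  have d3 : ∀ i j, h.coord₃ (X i j) = -v i j := fun i j => congrFun (congrFun h₃ i) j
  have hg : amp n h.gradedHom X = 0 := by
    ext i j
    refine (h.gradedHom_eq_zero_iff_of_odd (by rw [d2, d3])).2 ?_
    rw [d2]
    exact Submodule.mem_sup_left (hI i j)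
  have hgf : amp n (h.gradedHom.comp h.flip) X = 0 := by
    ext i j
    refine (h.gradedHom_eq_zero_iff_of_odd (x := h.flip (X i j)) ?_).2 ?_
    · rw [coord₃_flip, coord₂_flip, d2, d3, neg_neg]
    · rw [coord₂_flip, d3]
      exact neg_mem (Submodule.mem_sup_left (hI i j))
  have n1 : amp n h.coord₁ (negPart X) = 0 := by
    rw [map_negPart _ hX, h₁]
    exact (negPart_eq_zero_iff (.of_nonneg h0)).2 h0
  have n2 : amp n h.gradedHom (negPart X) = 0 := by
    rw [map_negPart _ hX, hg]
    exact (negPart_eq_zero_iff (.zero _)).2 le_rfl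
  have n3 : amp n (h.gradedHom.comp h.flip) (negPart X) = 0 := by
    rw [map_negPart _ hX, hgf]
    exact (negPart_eq_zero_iff (.zero _)).2 le_rfl
  have hT : amp n h.modelHom (negPart X) = 0 := by
    ext i j
    refine h.modelHom_eq_zero_iff.2 ⟨?_, congrFun (congrFun n2 i) j, congrFun (congrFun n3 i) j⟩
    rw [orderHom_eq_zero_iff, show h.coord₁ ((negPart X) i j) = 0 from congrFun (congrFun n1 i) j]
    exact zero_mem _
  rw [← negPart_eq_zero_iff (hX.map (amp n h.modelHom)), ← map_negPart _ hX, hT]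

/-- The model reflects complete positivity. If `T v ≥ 0` then the two graded components of `T v`,
which are opposite, vanish; so `v` has entries in `posSpan V`, and its negative part is killed by
the ungraded quotient, hence by the projection. -/
lemma nonneg_of_amp_modelHom (h₁ : amp n h.coord₁ X = v) (h₂ : amp n h.coord₂ X = v)
    (h₃ : amp n h.coord₃ X = -v) (hv : ∀ i j, v i j ∈ V) (h0 : 0 ≤ amp n h.modelHom X) :
    0 ≤ v := by
  have d1 : ∀ i j, h.coord₁ (X i j) = v i j := fun i j => congrFun (congrFun h₁ i) j
  have d2 : ∀ i j, h.coord₂ (X i j) = v i j := fun i j => congrFun (congrFun h₂ i) j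
  have d3 : ∀ i j, h.coord₃ (X i j) = -v i j := fun i j => congrFun (congrFun h₃ i) j
  have hvsa : IsSelfAdjoint v := by
    have e : amp n h.modelHom (star X - X) = 0 := by
      rw [map_sub, map_star, (IsSelfAdjoint.of_nonneg h0).star_eq, sub_self]
    have hx : ∀ i j, (star X - X) i j = star (X j i) - X i j := fun _ _ => rfl
    ext i j
    have c1 : h.coord₁ ((star X - X) i j) = star (v j i) - v i j := by
      rw [hx, map_sub, map_star, d1, d1]
    have := (h.modelHom_eq_zero_iff_of_odd (x := (star X - X) i j)
      (by rw [c1, hx, map_sub, map_star, d2, d2])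
      (by rw [c1, hx, map_sub, map_star, d3, d3, star_neg]; abel)).1 (congrFun (congrFun e i) j)
    rw [c1] at this
    exact sub_eq_zero.1 (h.eq_zero_of_mem (sub_mem (h.left_star _ (hv j i)) (hv i j)) this)
  have hX := h.isSelfAdjoint_of_coord h₁ h₂ h₃ hvsa
  have t1 : 0 ≤ amp n h.orderHom X := by
    have e : amp n h.target₁ (amp n h.modelHom X) = amp n h.orderHom X := by
      ext i j; exact h.target₁_modelHom (X i j)
    rw [← e]
    exact nonneg_map (amp n h.target₁) h0
  have t2 : 0 ≤ amp n h.gradedHom X := by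
    have e : amp n h.target₂ (amp n h.modelHom X) = amp n h.gradedHom X := by
      ext i j; exact h.target₂_modelHom (X i j)
    rw [← e]
    exact nonneg_map (amp n h.target₂) h0
  have t3 : 0 ≤ amp n (h.gradedHom.comp h.flip) X := by
    have e : amp n h.target₃ (amp n h.modelHom X) = amp n (h.gradedHom.comp h.flip) X := by
      ext i j; exact h.target₃_modelHom (X i j)
    rw [← e]
    exact nonneg_map (amp n h.target₃) h0
  have hneg : amp n (h.gradedHom.comp h.flip) X = -amp n h.gradedHom X := by
    rw [eq_neg_iff_add_eq_zero]
    ext i j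
    change h.gradedHom (h.flip (X i j)) + h.gradedHom (X i j) = 0
    rw [← map_add, gradedHom_eq_zero_iff, map_add, map_add, coord₂_flip, coord₃_flip, d2, d3]
    simp
  have hg : amp n h.gradedHom X = 0 := by
    rw [hneg] at t3
    exact le_antisymm (neg_nonneg.1 t3) t2
  have hI : ∀ i j, v i j ∈ posSpan V := by
    intro i j
    have := (h.gradedHom_eq_zero_iff_of_odd (x := X i j) (by rw [d2, d3])).1
      (congrFun (congrFun hg i) j)
    rw [d2] at this
    obtain ⟨w, hw, k, hk, e⟩ := Submodule.mem_sup.1 this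
    have hkV : k ∈ V := by
      rw [← eq_sub_iff_add_eq'] at e
      rw [e]
      exact sub_mem (hv i j) (h.posSpan_left_le hw)
    rwa [← e, h.eq_zero_of_mem hkV hk, add_zero]
  have hnJ : ∀ i j, negPart v i j ∈ posSpan Z :=
    h.tro.negPart_entry_mem_posSpan fun i j => h.posSpan_le_posSpan (hI i j)
  have n1 : amp n h.coord₁ (negPart X) = (negPart v) := by rw [map_negPart _ hX, h₁]
  have n2 : amp n h.orderHom (negPart X) = 0 := by
    rw [map_negPart _ hX]
    exact (negPart_eq_zero_iff (.of_nonneg t1)).2 t1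
  have hnK : ∀ i j, (negPart v) i j ∈ K := by
    intro i j
    have c1 : h.coord₁ ((negPart X) i j) = (negPart v) i j := congrFun (congrFun n1 i) j
    have c2 : h.orderHom ((negPart X) i j) = 0 := congrFun (congrFun n2 i) j
    rw [orderHom_eq_zero_iff, c1] at c2
    have c3 := (h.coord_mem ((negPart X) i j)).1
    rw [c1] at c3
    exact h.mem_right_of_mem_mulInto c3 c2 (h.posSpan_le_sup (hnJ i j))
  exact h.nonneg n v (negPart v) hv hnK (add_negPart_nonneg hvsa)

end IsSplitting
end Model

/-! ### The model as a `*`-TRO -/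

section Representation

variable {B : Type u} [NonUnitalCStarAlgebra B] [PartialOrder B] [StarOrderedRing B]
  {Z V K : Submodule ℂ B}

lemma norm_oneByOne (b : B) : ‖oneByOne B b‖ = ‖b‖ :=
  NonUnitalStarAlgHom.norm_map (oneByOne B) (oneByOne_injective B) b

lemma oneByOne_nonneg_iff {b : B} : 0 ≤ oneByOne B b ↔ 0 ≤ b :=
  ⟨nonneg_of_nonneg_map (oneByOne B) (oneByOne_injective B), nonneg_map (oneByOne B)⟩

omit [PartialOrder B] [StarOrderedRing B] in
lemma mem_matSpace_iff {n : ℕ} {b : CStarMatrix (Fin n) (Fin n) B} :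
    b ∈ matSpace V n ↔ ∀ i j, b i j ∈ V := by
  constructor
  · rintro ⟨x, rfl⟩ i j
    exact (x i j).2
  · intro hb
    exact ⟨fun i j => ⟨b i j, hb i j⟩, rfl⟩

namespace IsSplitting

variable (h : IsSplitting Z V K)

/-- The embedding of `V` as a `*`-TRO. -/
noncomputable def modelMap : V →ₗ[ℂ] h.Target where
  toFun v := h.modelHom (h.embed v)
  map_add' x y := by rw [map_add, map_add]
  map_smul' t x := by rw [map_smul, map_smul, RingHom.id_apply]

lemma modelMap_injective : Function.Injective h.modelMap :=
  (injective_iff_map_eq_zero h.modelMap).2 fun _ hv => h.modelHom_embed_eq_zero_iff.1 hv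

/-- The `*`-TRO that is completely isometrically and completely order isomorphic to `V`. -/
noncomputable def model : Submodule ℂ h.Target := LinearMap.range h.modelMap

/-- The isomorphism of `V` with its model. -/
noncomputable def modelEquiv : V ≃ₗ[ℂ] h.model :=
  LinearEquiv.ofInjective h.modelMap h.modelMap_injective

lemma norm_toMat_map_modelEquiv {n : ℕ} (x : Matrix (Fin n) (Fin n) V) :
    ‖toMat (x.map h.modelEquiv)‖ = ‖toMat x‖ :=
  h.norm_amp_modelHom (X := CStarMatrix.ofMatrix (x.map h.embed)) rfl rfl rfl
    fun i j => (x i j).2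

lemma toMat_map_modelEquiv_nonneg_iff {n : ℕ} (x : Matrix (Fin n) (Fin n) V) :
    0 ≤ toMat (x.map h.modelEquiv) ↔ 0 ≤ toMat x :=
  ⟨h.nonneg_of_amp_modelHom (X := CStarMatrix.ofMatrix (x.map h.embed)) rfl rfl rfl
    fun i j => (x i j).2,
  h.amp_modelHom_nonneg (X := CStarMatrix.ofMatrix (x.map h.embed)) rfl rfl rfl
    fun i j => (x i j).2⟩

lemma norm_modelEquiv (v : V) : ‖(h.modelEquiv v : h.Target)‖ = ‖v‖ := by
  have := h.norm_toMat_map_modelEquiv (n := 1) fun _ _ => v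
  have e1 : toMat (n := 1) (fun _ _ => v) = oneByOne B v := rfl
  have e2 : toMat (Matrix.map (fun _ _ => v : Matrix (Fin 1) (Fin 1) V) h.modelEquiv) =
    oneByOne h.Target (h.modelEquiv v) := rfl
  rwa [e1, e2, norm_oneByOne, norm_oneByOne] at this

lemma modelEquiv_nonneg_iff (v : V) : 0 ≤ (h.modelEquiv v : h.Target) ↔ 0 ≤ (v : B) := by
  have := h.toMat_map_modelEquiv_nonneg_iff (n := 1) fun _ _ => v
  have e1 : toMat (n := 1) (fun _ _ => v) = oneByOne B v := rfl
  have e2 : toMat (Matrix.map (fun _ _ => v : Matrix (Fin 1) (Fin 1) V) h.modelEquiv) =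
    oneByOne h.Target (h.modelEquiv v) := rfl
  rwa [e1, e2, oneByOne_nonneg_iff, oneByOne_nonneg_iff] at this

lemma embed_star {x y : V} (hxy : (y : B) = star (x : B)) : h.embed y = star (h.embed x) := by
  refine h.alg_ext ?_ ?_ ?_ <;>
    simp only [map_star, coord₁_embed, coord₂_embed, coord₃_embed, hxy, star_neg]

lemma isStarLinear_modelEquiv : IsStarLinear h.modelEquiv.toLinearMap := fun x y hxy => by
  change h.modelHom (h.embed y) = star (h.modelHom (h.embed x))
  rw [h.embed_star hxy, map_star]

/-- The model turns the compression to `V` of the ternary product of `Z` into the ternary product of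
the target: the difference of the two sides comes from an element `(k, k, -k)` with `k ∈ K`. -/
lemma modelEquiv_triple {x y z w : V} (hw : (x : B) * star (y : B) * z - w ∈ K) :
    (h.modelEquiv w : h.Target) = h.modelEquiv x * star (h.modelEquiv y : h.Target) *
      h.modelEquiv z := by
  have key : h.modelHom (h.embed x * star (h.embed y) * h.embed z - h.embed w) = 0 := by
    refine (h.modelHom_eq_zero_iff_of_odd ?_ ?_).2 ?_ <;>
      simp only [map_sub, map_mul, map_star, coord₁_embed, coord₂_embed, coord₃_embed]
    · rw [star_neg]
      noncomm_ring
    · exact hw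
  simp only [map_sub, map_mul, map_star] at key
  exact (sub_eq_zero.1 key).symm

lemma isStarTRO_model : IsStarTRO h.model where
  isClosed := by
    have : CompleteSpace V := h.left_closed.completeSpace_coe
    have hi : Isometry h.modelMap := AddMonoidHomClass.isometry_of_norm _ h.norm_modelEquiv
    have := hi.isClosedEmbedding.isClosed_range
    rwa [← LinearMap.coe_range] at this
  star_mem := by
    rintro _ ⟨v, rfl⟩
    exact ⟨⟨star v, h.left_star v v.2⟩, h.isStarLinear_modelEquiv v _ rfl⟩
  triple_mem := by
    rintro _ ⟨x, rfl⟩ _ ⟨y, rfl⟩ _ ⟨z, rfl⟩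
    obtain ⟨w, hw, hwk⟩ := h.exists_sub_mem ((x : B) * star (y : B) * z)
      (h.tro.triple_mem _ (h.left_le x.2) _ (h.left_le y.2) _ (h.left_le z.2))
    exact ⟨⟨w, hw⟩, h.modelEquiv_triple hwk⟩

end IsSplitting

end Representation

/-! ### Range and kernel of a completely positive projection -/

section Projection

variable {B : Type u} [NonUnitalCStarAlgebra B] [PartialOrder B] [StarOrderedRing B]
  {Z : Submodule ℂ B} {P : Z →ₗ[ℂ] Z}

omit [PartialOrder B] [StarOrderedRing B] in
lemma mem_rangeIn_iff (hidem : ∀ z : Z, P (P z) = P z) {b : B} :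
    b ∈ rangeIn P ↔ ∃ z : Z, P z = z ∧ (z : B) = b := by
  constructor
  · rintro ⟨_, ⟨z, rfl⟩, rfl⟩
    exact ⟨P z, hidem z, rfl⟩
  · rintro ⟨z, hz, rfl⟩
    exact ⟨z, ⟨z, hz⟩, rfl⟩

omit [PartialOrder B] [StarOrderedRing B] in
lemma coe_apply_mem_rangeIn (z : Z) : (P z : B) ∈ rangeIn P := ⟨P z, ⟨z, rfl⟩, rfl⟩

omit [PartialOrder B] [StarOrderedRing B] in
lemma rangeIn_le : rangeIn P ≤ Z := Submodule.map_subtype_le _ _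

lemma IsCompletelyContractive.norm_le (hcc : IsCompletelyContractive P) (z : Z) : ‖P z‖ ≤ ‖z‖ := by
  have := hcc 1 fun _ _ => z
  have e1 : toMat (n := 1) (fun _ _ => z) = oneByOne B z := rfl
  have e2 : toMat (Matrix.map (fun _ _ => z : Matrix (Fin 1) (Fin 1) Z) P) =
    oneByOne B (P z) := rfl
  rwa [e1, e2, norm_oneByOne, norm_oneByOne] at this

lemma IsCompletelyPositive.nonneg (hcp : IsCompletelyPositive P) {z : Z} (hz : 0 ≤ (z : B)) :
    0 ≤ (P z : B) := by
  have := hcp.2 1 fun _ _ => z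
  have e1 : toMat (n := 1) (fun _ _ => z) = oneByOne B z := rfl
  have e2 : toMat (Matrix.map (fun _ _ => z : Matrix (Fin 1) (Fin 1) Z) P) =
    oneByOne B (P z) := rfl
  rw [e1, e2, oneByOne_nonneg_iff, oneByOne_nonneg_iff] at this
  exact this hz

omit [PartialOrder B] [StarOrderedRing B] in
lemma exists_toMat_of_mem_add_mem (hidem : ∀ z : Z, P (P z) = P z) {n : ℕ}
    {x y : CStarMatrix (Fin n) (Fin n) B} (hx : ∀ i j, x i j ∈ rangeIn P)
    (hy : ∀ i j, y i j ∈ (LinearMap.ker P).map Z.subtype) :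
    ∃ X : Matrix (Fin n) (Fin n) Z, toMat X = x + y ∧ toMat (X.map P) = x := by
  choose v hv hvx using fun i j => (mem_rangeIn_iff hidem).1 (hx i j)
  choose k hk hky using hy
  refine ⟨fun i j => v i j + k i j, ?_, ?_⟩
  · ext i j
    change (v i j : B) + k i j = x i j + y i j
    rw [hvx, ← hky]; rfl
  · ext i j
    change (P (v i j + k i j) : B) = x i j
    rw [map_add, hv, show P (k i j) = 0 from hk i j, add_zero, hvx]

/-- The range and the kernel of a completely positive completely contractive idempotent. -/
lemma isSplitting (hZ : IsStarTRO Z) (hidem : ∀ z : Z, P (P z) = P z)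
    (hcp : IsCompletelyPositive P) (hcc : IsCompletelyContractive P) :
    IsSplitting Z (rangeIn P) ((LinearMap.ker P).map Z.subtype) := by
  have hc : Continuous P := (P.mkContinuous 1 fun z => by
    rw [one_mul]; exact hcc.norm_le z).continuous
  have hcl : ∀ s : Set Z, IsClosed s → IsClosed ((↑) '' s : Set B) :=
    hZ.isClosed.isClosedEmbedding_subtypeVal.isClosedMap
  refine ⟨hZ, rangeIn_le, Submodule.map_subtype_le _ _, ?_, ?_, ?_, ?_, ?_, ?_, ?_⟩
  · have : (rangeIn P : Set B) = (↑) '' {z : Z | P z = z} := by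
      ext b; exact mem_rangeIn_iff hidem
    rw [this]
    exact hcl _ (isClosed_eq hc continuous_id)
  · exact hcl _ (isClosed_singleton.preimage hc)
  · intro b hb
    obtain ⟨z, hz, rfl⟩ := (mem_rangeIn_iff hidem).1 hb
    refine (mem_rangeIn_iff hidem).2 ⟨⟨star z, hZ.star_mem _ z.2⟩, Subtype.ext ?_, rfl⟩
    rw [hcp.1 z _ rfl, hz]
  · rintro _ ⟨z, hz, rfl⟩
    refine ⟨⟨star z, hZ.star_mem _ z.2⟩, Subtype.ext ?_, rfl⟩
    rw [hcp.1 z _ rfl, show P z = 0 from hz]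
    exact star_zero B
  · intro b hb
    refine ⟨P ⟨b, hb⟩, coe_apply_mem_rangeIn _, ⟨⟨b, hb⟩ - P ⟨b, hb⟩, ?_, rfl⟩⟩
    change P _ = 0
    rw [map_sub, hidem, sub_self]
  · intro n x y hx hy
    obtain ⟨X, hX, hPX⟩ := exists_toMat_of_mem_add_mem hidem hx hy
    rw [← hX, ← hPX]
    exact hcc n X
  · intro n x y hx hy hxy
    obtain ⟨X, hX, hPX⟩ := exists_toMat_of_mem_add_mem hidem hx hy
    rw [← hX] at hxy
    rw [← hPX]
    exact hcp.2 n X hxy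

lemma rangeIn_inter_posCone (hidem : ∀ z : Z, P (P z) = P z) (hcp : IsCompletelyPositive P) :
    (rangeIn P : Set B) ∩ posCone Z = {b | ∃ z : Z, 0 ≤ (z : B) ∧ (P z : B) = b} := by
  ext b
  constructor
  · rintro ⟨hb, -, h0⟩
    obtain ⟨z, hz, rfl⟩ := (mem_rangeIn_iff hidem).1 hb
    exact ⟨z, h0, by rw [hz]⟩
  · rintro ⟨z, h0, rfl⟩
    exact ⟨coe_apply_mem_rangeIn z, (P z).2, hcp.nonneg h0⟩

lemma matSpace_inter_matPosCone (hidem : ∀ z : Z, P (P z) = P z) (hcp : IsCompletelyPositive P)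
    (n : ℕ) : matSpace (rangeIn P) n ∩ matPosCone Z n =
      {b | ∃ x : Matrix (Fin n) (Fin n) Z, 0 ≤ toMat x ∧ toMat (x.map P) = b} := by
  ext b
  constructor
  · rintro ⟨hb, -, h0⟩
    obtain ⟨X, hX, hPX⟩ := exists_toMat_of_mem_add_mem (y := 0) hidem (mem_matSpace_iff.1 hb)
      fun _ _ => zero_mem _
    rw [add_zero] at hX
    exact ⟨X, hX ▸ h0, hPX⟩
  · rintro ⟨x, h0, rfl⟩
    exact ⟨mem_matSpace_iff.2 fun i j => coe_apply_mem_rangeIn (x i j), ⟨x.map P, rfl⟩,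
      hcp.2 n x h0⟩

end Projection

end OrderedTRO

theorem theorem4p20 {B : Type u} [NonUnitalCStarAlgebra B] [PartialOrder B] [StarOrderedRing B]
    (Z : Submodule ℂ B) (hZ : OrderedTRO.IsStarTRO Z)
    (P : Z →ₗ[ℂ] Z) (hidem : ∀ z : Z, P (P z) = P z)
    (hcp : OrderedTRO.IsCompletelyPositive P)
    (hcc : OrderedTRO.IsCompletelyContractive P) :
    -- the two cones on `P(Z)` agree, at every matrix level
    ((OrderedTRO.rangeIn P : Set B) ∩ OrderedTRO.posCone Z =
        {b | ∃ z : Z, 0 ≤ (z : B) ∧ (P z : B) = b}) ∧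
    (∀ n : ℕ, OrderedTRO.matSpace (OrderedTRO.rangeIn P) n ∩ OrderedTRO.matPosCone Z n =
        {b | ∃ x : Matrix (Fin n) (Fin n) Z,
          0 ≤ OrderedTRO.toMat x ∧ OrderedTRO.toMat (x.map P) = b}) ∧
    -- `P(Z)` is an involutive ternary system, on which these cones are natural
    (∃ m : OrderedTRO.rangeIn P → OrderedTRO.rangeIn P → OrderedTRO.rangeIn P →
          OrderedTRO.rangeIn P,
      OrderedTRO.IsInvolutiveTernarySystem (OrderedTRO.rangeIn P) m ∧
      OrderedTRO.IsNaturalCone (OrderedTRO.rangeIn P) m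
        ((OrderedTRO.rangeIn P : Set B) ∩ OrderedTRO.posCone Z) ∧
      OrderedTRO.IsNaturalMatrixCones (OrderedTRO.rangeIn P) m
        (fun n => OrderedTRO.matSpace (OrderedTRO.rangeIn P) n ∩ OrderedTRO.matPosCone Z n)) ∧
    -- `P(Z)` is completely isometrically completely order isomorphic to a `*`-TRO
    (∃ (A : Type u) (_ : NonUnitalCStarAlgebra A) (_ : PartialOrder A) (_ : StarOrderedRing A)
      (W : Submodule ℂ A), OrderedTRO.IsStarTRO W ∧
        ∃ T : OrderedTRO.rangeIn P ≃ₗ[ℂ] W,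
          OrderedTRO.IsCompletelyIsometric T.toLinearMap ∧
          OrderedTRO.IsCompletelyPositive T.toLinearMap ∧
          OrderedTRO.IsCompletelyPositive T.symm.toLinearMap) := by
  open OrderedTRO in
  have h := isSplitting hZ hidem hcp hcc
  have hT : ∀ x y z : rangeIn P, (x : B) * star (y : B) * z ∈ Z := fun x y z =>
    hZ.triple_mem _ (rangeIn_le x.2) _ (rangeIn_le y.2) _ (rangeIn_le z.2)
  let m : rangeIn P → rangeIn P → rangeIn P → rangeIn P := fun x y z =>
    ⟨P ⟨(x : B) * star (y : B) * z, hT x y z⟩, coe_apply_mem_rangeIn _⟩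
  have hm : IsTernaryStarMorphism m h.modelEquiv.toLinearMap := by
    refine ⟨h.isStarLinear_modelEquiv, fun x y z => h.modelEquiv_triple ?_⟩
    refine ⟨⟨_, hT x y z⟩ - P ⟨_, hT x y z⟩, ?_, rfl⟩
    change P _ = 0
    rw [map_sub, hidem, sub_self]
  have hiso : IsCompletelyIsometric h.modelEquiv.toLinearMap := fun n x =>
    h.norm_toMat_map_modelEquiv x
  refine ⟨rangeIn_inter_posCone hidem hcp, matSpace_inter_matPosCone hidem hcp,
    ⟨m, ⟨h.left_star, h.Target, _, _, inferInstance, h.model, h.isStarTRO_model,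
      h.modelEquiv, hm, hiso⟩,
      ⟨h.Target, _, _, inferInstance, h.model, h.isStarTRO_model, h.modelEquiv, hm, ?_⟩,
      ⟨h.Target, _, _, inferInstance, h.model, h.isStarTRO_model, h.modelEquiv, hm, fun n => ?_⟩⟩,
    ⟨h.Target, _, _, inferInstance, h.model, h.isStarTRO_model, h.modelEquiv, hiso,
      ⟨h.isStarLinear_modelEquiv, fun n x hx => ?_⟩, ⟨fun x y hxy => ?_, fun n x hx => ?_⟩⟩⟩
  · ext b
    constructor
    · rintro ⟨hb, -, h0⟩
      exact ⟨⟨b, hb⟩, rfl, (h.modelEquiv_nonneg_iff _).2 h0⟩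
    · rintro ⟨x, rfl, hx⟩
      exact ⟨x.2, rangeIn_le x.2, (h.modelEquiv_nonneg_iff x).1 hx⟩
  · ext b
    constructor
    · rintro ⟨⟨x, rfl⟩, -, h0⟩
      exact ⟨x, rfl, (h.toMat_map_modelEquiv_nonneg_iff x).2 h0⟩
    · rintro ⟨x, rfl, hx⟩
      exact ⟨⟨x, rfl⟩, mem_matSpace_iff.2 fun i j => rangeIn_le (x i j).2,
        (h.toMat_map_modelEquiv_nonneg_iff x).1 hx⟩
  · exact (h.toMat_map_modelEquiv_nonneg_iff x).2 hx
  · have hs : star (h.modelEquiv.symm x : B) ∈ rangeIn P := h.left_star _ (Subtype.mem _)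
    have hstar := h.isStarLinear_modelEquiv (h.modelEquiv.symm x) ⟨_, hs⟩ rfl
    rw [LinearEquiv.coe_coe, h.modelEquiv.apply_symm_apply] at hstar
    have e : y = h.modelEquiv ⟨_, hs⟩ := Subtype.ext (hxy.trans hstar.symm)
    rw [e]
    exact congrArg Subtype.val (h.modelEquiv.symm_apply_apply _)
  · refine (h.toMat_map_modelEquiv_nonneg_iff _).1 ?_
    have e : (x.map h.modelEquiv.symm.toLinearMap).map h.modelEquiv = x := by
      ext i j
      exact congrArg Subtype.val (h.modelEquiv.apply_symm_apply (x i j))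
    rw [e]
    exact hx
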